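/- Let $n\ge 1$ and $[n]=\{1,\dots,n\}$, and let $\log$ be the logarithm to base $2$. For $f\colon\{\pm1\}^n\to\mathbb R$ and $S\subseteq[n]$ let $\hat f(S)=\mathbb E_x\big[f(x)\prod_{i\in S}x_i\big]$, where $x$ is uniform in $\{\pm1\}^n$, and let $L_{1,\ell}(f)=\sum_{S\subseteq[n],\,|S|=\ell}|\hat f(S)|$. A *parity decision tree* on $n$ variables is a finite rooted binary tree with leaves labeled $0$ or $1$, in which each internal node $v$ is labeled by a set $Q_v\subseteq[n]$ and has two outgoing edges labeled $+1$ and $-1$. At $v$ an input $x\in\{\pm1\}^n$ follows the edge labeled $\prod_{i\in Q_v}x_i$, and the output is the label of the leaf reached. It is required that the indicator vector of $Q_v$ is not in the $\mathbb F_2$-span of the indicator vectors of the sets at the proper ancestors of $v$ (in particular $Q_v\neq\emptyset$). The depth is the maximal number of internal nodes on a root-to-leaf path. A *randomized parity decision tree* $\mathcal T$ of depth at most $d$ is a probability distribution over parity decision trees of depth at most $d$. A *noisy decision tree* on $n$ variables is a finite rooted binary tree with leaves labeled $0$ or $1$, in which each internal node $v$ is labeled by an index $q_v\in[n]$ and a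 correlation $\gamma_v\in[-1,1]$ and has two outgoing edges labeled $+1$ and $-1$. At $v$ the computation on $x$ follows, independently of all other queries, the edge labeled $x_{q_v}$ with probability $(1+\gamma_v)/2$ and the edge labeled $-x_{q_v}$ with probability $(1-\gamma_v)/2$; the output is the label of the leaf reached. The cost is the maximum over root-to-leaf paths of $\sum_v\gamma_v^2$, summed over the internal nodes $v$ on the path. A *randomized noisy decision tree* $\mathcal T'$ of cost at most $d$ is a probability distribution over noisy decision trees of cost at most $d$ (with respect to a $\sigma$-algebra for which the probability of outputting $1$ on each input is measurable). For a randomized tree, $L_{1,\ell}$ is that of the function mapping $x$ to its expected output on $x$, where the expectation is over the choice of the tree and, for noisy trees, also over the noise of the queries. There are absolute constants $C,C'>0$ with the following properties. 1. For all integers $n\ge2$ and $d\ge0$, every randomized parity decision tree $\mathcal T$ of depth at most $d$ on $n$ variables and every $\ell\in[n]$, $$L_{1,\ell}(\mathcal T)\le d^{\ell/2}\cdot\big(C\,\ell\log n\big)^{\ell}.$$ 2. For all integers $n\ge1$, all real $d\ge0$, every randomized noisy decision tree $\mathcal T'$ of cost at most $d$ on $n$ variables and every $\ell\in[n]$, $$L_{1,\ell}(\mathcal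 T')\le (C'd)^{\ell/2}\cdot\big(\ell\log n\big)^{(\ell-1)/2},$$ where $0^0=1$ (which is used only for $n=\ell=1$). -/

import Mathlib

open MeasureTheory

/-- The Boolean hypercube `{±1}^n`; the units of `ℤ` are exactly `1` and `-1`. -/
abbrev Cube (n : ℕ) : Type := Fin n → ℤˣ

/-- The monomial `x_S = ∏_{i ∈ S} x_i`, as an element of `{±1}`. -/
def Cube.parity {n : ℕ} (S : Finset (Fin n)) (x : Cube n) : ℤˣ := ∏ i ∈ S, x i

/-- The Fourier coefficient `f̂(S) = E_x [f(x) x_S]`, for `x` uniform in `{±1}^n`. -/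
noncomputable def cubeFourierCoeff {n : ℕ} (f : Cube n → ℝ) (S : Finset (Fin n)) : ℝ :=
  (∑ x : Cube n, f x * (((Cube.parity S x : ℤˣ) : ℤ) : ℝ)) / 2 ^ n

/-- `L_{1,ℓ}(f)`, the sum of `|f̂(S)|` over the sets `S ⊆ [n]` of size exactly `ℓ`. -/
noncomputable def levelL1 {n : ℕ} (l : ℕ) (f : Cube n → ℝ) : ℝ :=
  ∑ S ∈ Finset.powersetCard l (Finset.univ : Finset (Fin n)), |cubeFourierCoeff f S|

/-! ### Parity decision trees -/

/-- Binary trees whose internal nodes are labeled by a set `Q ⊆ [n]`, with one subtree for the edge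
labeled `+1` and one for the edge labeled `-1`, and whose leaves are labeled by `0` or `1`
(`false` or `true`). -/
inductive ParityTree (n : ℕ) : Type
  | leaf (b : Bool) : ParityTree n
  | node (Q : Finset (Fin n)) (pos neg : ParityTree n) : ParityTree n

namespace ParityTree

variable {n : ℕ}

/-- The label in `{0, 1}` of the leaf reached by the computation path of `x`. -/
def eval : ParityTree n → Cube n → Bool
  | leaf b, _ => b
  | node Q pos neg, x => if Cube.parity Q x = 1 then pos.eval x else neg.eval x

/-- The maximal number of queries on a root-to-leaf path. -/
def depth : ParityTree n → ℕ
  | leaf _ => 0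
  | node _ pos neg => max pos.depth neg.depth + 1

/-- The indicator vector in `𝔽₂^n` of a set `Q ⊆ [n]`. -/
def indicatorVec (Q : Finset (Fin n)) : Fin n → ZMod 2 := fun i => if i ∈ Q then 1 else 0

/-- No query of the tree is implied by the queries of its ancestors or by those in `A`:
its indicator vector is not in their span over `𝔽₂`. (In particular, no query is the empty set.) -/
def NonredundantFrom : Set (Finset (Fin n)) → ParityTree n → Prop
  | _, leaf _ => True
  | A, node Q pos neg =>
      indicatorVec Q ∉ Submodule.span (ZMod 2) (indicatorVec '' A) ∧
        pos.NonredundantFrom (insert Q A) ∧ neg.NonredundantFrom (insert Q A)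

end ParityTree

/-- Parity decision trees on `n` variables: no query is implied by its ancestors' queries. -/
def PDT (n : ℕ) : Type := {T : ParityTree n // T.NonredundantFrom ∅}

/-- There are only countably many parity decision trees, so distributions on them are discrete. -/
instance (n : ℕ) : MeasurableSpace (PDT n) := ⊤

/-- A randomized parity decision tree of depth at most `d` on `n` variables: a probability
distribution over parity decision trees of depth at most `d`. -/
structure RandomizedPDT (n d : ℕ) where
  law : Measure (PDT n)
  isProbabilityMeasure : IsProbabilityMeasure law
  depth_le : ∀ᵐ T ∂law, T.1.depth ≤ d

/-- The function computed by a randomized parity decision tree: its expected output on input `x`,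
which is the probability that it outputs `1`. -/
noncomputable def RandomizedPDT.toFun {n d : ℕ} (R : RandomizedPDT n d) (x : Cube n) : ℝ :=
  ∫ T, (if T.1.eval x = true then (1 : ℝ) else 0) ∂(R.law)

/-! ### Noisy decision trees -/

/-- Noisy decision trees on `n` variables: an internal node carries the index `q` of the queried
variable, a correlation `γ ∈ [-1, 1]`, and one subtree for each of the outcomes `+1` and `-1`;
leaves are labeled by `0` or `1` (`false` or `true`). -/
inductive NoisyTree (n : ℕ) : Type
  | leaf (b : Bool) : NoisyTree n
  | node (q : Fin n) (γ : Set.Icc (-1 : ℝ) 1) (pos neg : NoisyTree n) : NoisyTree n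

/-- The probability that a noisy query with correlation `γ` to the bit `b` returns `b'`. -/
noncomputable def noisyQueryProb (γ : ℝ) (b b' : ℤˣ) : ℝ :=
  if b' = b then (1 + γ) / 2 else (1 - γ) / 2

namespace NoisyTree

variable {n : ℕ}

/-- The probability, over the randomness of the noisy queries, that the tree outputs `1` on
input `x`. This is the expected output of the tree on input `x`. -/
noncomputable def acceptProb : NoisyTree n → Cube n → ℝ
  | leaf b, _ => if b = true then 1 else 0
  | node q γ pos neg, x =>
      noisyQueryProb γ (x q) 1 * pos.acceptProb x + noisyQueryProb γ (x q) (-1) * neg.acceptProb x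

/-- The maximum, over root-to-leaf paths, of the sum of `γ²` over the queries along the path. -/
noncomputable def cost : NoisyTree n → ℝ
  | leaf _ => 0
  | node _ γ pos neg => (γ : ℝ) ^ 2 + max pos.cost neg.cost

end NoisyTree

/-- A randomized noisy decision tree of cost at most `d` on `n` variables: a probability
distribution over noisy decision trees of cost at most `d`, on any σ-algebra of noisy decision trees
for which the acceptance probability of every input is measurable. -/
structure RandomizedNoisyTree (n : ℕ) (d : ℝ) where
  sigmaAlgebra : MeasurableSpace (NoisyTree n)
  law : Measure (NoisyTree n)
  isProbabilityMeasure : IsProbabilityMeasure law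
  measurable_acceptProb : ∀ x : Cube n, Measurable fun T : NoisyTree n => T.acceptProb x
  cost_le : ∀ᵐ T ∂law, T.cost ≤ d

/-- The function computed by a randomized noisy decision tree: its expected output on input `x`,
over the choice of the tree and the noise of its queries. -/
noncomputable def RandomizedNoisyTree.toFun {n : ℕ} {d : ℝ} (R : RandomizedNoisyTree n d)
    (x : Cube n) : ℝ :=
  letI := R.sigmaAlgebra
  ∫ T, T.acceptProb x ∂(R.law)

/-! ### Moments of a mean-zero perturbation -/

/-! By duality the level-`l` weight of `f` is E[f P], where P is the level-`l` polynomial whose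
coefficients are the signs of those of `f`. It therefore suffices to bound the correlation of a
single deterministic or noisy tree with every P = Σ a_S x_S, |a_S| ≤ 1 (`levelL1_integral_le`).

Both kinds of tree are controlled by the potential Φ(m) = Σ_S L^(p|S|) (∂_S P(m))^p with p = 2(⌊log
n⌋ + 1). As P is affine in each coordinate, a mean-zero step in coordinate i moves ∂_S P by a
multiple of ∂_(S∪i) P. Steps of size at most s thus raise the expected Φ by a factor of at most
exp(p²s²/L²) (`derivPotential_step`). L is chosen to make the total growth e^p. Since Φ(0) ≤ L^(pl)
n^l and n ≤ 2^p, after p-th roots ∂_S P is typically at most O(1)^l L^(l-|S|).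

Noisy trees: given the answers so far, x has a product distribution, and a query of correlation γ
moves one mean by at most 2|γ|, so L² ≈ pd suffices. The second moment of P(m) grows by at most
4γ²(∂_q P)² per query, and ∂_q P has order L^(l-1). Hence E|P| is of order √d L^(l-1), which saves a
factor √(log n) (`NoisyTree.abs_sum_acceptProb_mul_le`).

Parity trees: the answers fix a space U of known parities. For the analysis, the coordinates of a
set J are revealed as well, where J is clean: a known parity with at most K = lp coordinates outside
J lies inside J. This takes at most K dim U coordinates. As Φ has degree at most K in the revealed
bits, newly revealed coordinates look to it like fair signs, so the step bound applies with s = 1,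
at most lpd times. Then L² ≈ l d p² and E|P| is of order L^l (`ParityTree.abs_sum_eval_mul_le`). -/

theorem Real.exp_le_add_exp_sq {y : ℝ} (hy : 0 ≤ y) : Real.exp y ≤ y + Real.exp (y ^ 2) := by
  rcases le_total y 1 with h | h
  · have h1 := Real.abs_exp_sub_one_sub_id_le (x := y) (by rwa [abs_of_nonneg hy])
    have h2 := (abs_le.1 h1).2
    have h3 := Real.add_one_le_exp (y ^ 2)
    linarith
  · have : Real.exp y ≤ Real.exp (y ^ 2) := Real.exp_le_exp.2 (by nlinarith)
    linarith

/-- The second-order Taylor remainder of `X ↦ X ^ p` is largest at the extreme arguments. -/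
theorem abs_pow_taylor_remainder_le {X δ Z t : ℝ} (hX : |X| ≤ Z) (hδ : |δ| ≤ t * Z)
    (ht : 0 ≤ t) (p : ℕ) :
    |(X + δ) ^ p - X ^ p - p * X ^ (p - 1) * δ| ≤ Z ^ p * ((1 + t) ^ p - 1 - p * t) := by
  have hZ : 0 ≤ Z := (abs_nonneg X).trans hX
  induction p with
  | zero => simp
  | succ p ih =>
    -- The remainder r_p satisfies r_(p+1) = (X + δ) r_p + p X^(p-1) δ². The claimed bound obeys the
    -- same recursion with X, δ replaced by Z, tZ.
    have e1 : (X + δ) ^ (p + 1) - X ^ (p + 1) - ((p + 1 : ℕ) : ℝ) * X ^ (p + 1 - 1) * δ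
        = (X + δ) * ((X + δ) ^ p - X ^ p - p * X ^ (p - 1) * δ) + p * X ^ (p - 1) * δ ^ 2 := by
      cases p with
      | zero => simp
      | succ k => simp only [Nat.add_sub_cancel]; push_cast; ring
    have e2 : Z ^ (p + 1) * ((1 + t) ^ (p + 1) - 1 - ((p + 1 : ℕ) : ℝ) * t)
        = ((1 + t) * Z) * (Z ^ p * ((1 + t) ^ p - 1 - p * t)) + p * Z ^ (p - 1) * (t * Z) ^ 2 := by
      cases p with
      | zero => simp
      | succ k => simp only [Nat.add_sub_cancel]; push_cast; ring
    rw [e1, e2]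
    refine (abs_add_le _ _).trans (add_le_add ?_ ?_)
    · rw [abs_mul]
      refine mul_le_mul ?_ ih (abs_nonneg _) (by positivity)
      exact (abs_add_le _ _).trans (by linarith)
    · rw [abs_mul, abs_mul, abs_pow, abs_pow, Nat.abs_cast]
      gcongr

/-- If `η` takes two values of size at most `s` and has mean zero, the `p`-th moment of `X + η Y`
exceeds `X ^ p` by little, relative to `X ^ p + (L Y) ^ p`. -/
theorem two_point_moment_le {p : ℕ} (hp : Even p) {w₁ w₂ η₁ η₂ s L : ℝ} (X Y : ℝ)
    (hw₁ : 0 ≤ w₁) (hw₂ : 0 ≤ w₂) (hw : w₁ + w₂ = 1) (hη : w₁ * η₁ + w₂ * η₂ = 0)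
    (hη₁ : |η₁| ≤ s) (hη₂ : |η₂| ≤ s) (hL : 0 < L) :
    w₁ * (X + η₁ * Y) ^ p + w₂ * (X + η₂ * Y) ^ p
      ≤ X ^ p + (Real.exp (p ^ 2 * s ^ 2 / L ^ 2) - 1) * (X ^ p + L ^ p * Y ^ p) := by
  have hs : 0 ≤ s := (abs_nonneg _).trans hη₁
  -- On the scale Z the perturbation is relatively at most t = s/L, while Z^p is still at most X^p +
  -- (L Y)^p. The linear Taylor term has mean zero.
  set Z := max |X| (L * |Y|) with hZ
  set t := s / L with ht
  have ht0 : 0 ≤ t := by positivity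
  have hZ0 : 0 ≤ Z := (abs_nonneg X).trans (le_max_left _ _)
  have hsm : ∀ η : ℝ, |η| ≤ s → |η * Y| ≤ t * Z := by
    intro η h
    rw [abs_mul]
    calc |η| * |Y| ≤ s * |Y| := by gcongr
      _ = t * (L * |Y|) := by rw [ht]; field_simp
      _ ≤ t * Z := by gcongr; exact le_max_right _ _
  have key : ∀ η : ℝ, |η| ≤ s → (X + η * Y) ^ p ≤
      X ^ p + p * X ^ (p - 1) * Y * η + Z ^ p * ((1 + t) ^ p - 1 - p * t) := by
    intro η h
    have := (abs_le.1 (abs_pow_taylor_remainder_le (le_max_left _ _) (hsm η h) ht0 p)).2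
    rw [← hZ] at this
    linarith
  have hr : (1 + t) ^ p - 1 - p * t ≤ Real.exp (p ^ 2 * s ^ 2 / L ^ 2) - 1 := by
    have h1 : (1 + t) ^ p ≤ Real.exp (p * t) := by
      rw [Real.exp_nat_mul]
      gcongr
      have := Real.add_one_le_exp t
      linarith
    have h2 := Real.exp_le_add_exp_sq (y := p * t) (by positivity)
    have h3 : (p * t) ^ 2 = p ^ 2 * s ^ 2 / L ^ 2 := by rw [ht]; field_simp
    rw [h3] at h2
    linarith
  have hZp : Z ^ p ≤ X ^ p + L ^ p * Y ^ p := by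
    have hX := hp.pow_nonneg X
    have hY := hp.pow_nonneg Y
    have hLp : 0 ≤ L ^ p := by positivity
    rcases max_cases |X| (L * |Y|) with h | h
    · rw [hZ, h.1, hp.pow_abs]; nlinarith
    · rw [hZ, h.1, mul_pow, hp.pow_abs]; linarith
  have hexp : 0 ≤ Real.exp (p ^ 2 * s ^ 2 / L ^ 2) - 1 := by
    have := Real.one_le_exp (x := p ^ 2 * s ^ 2 / L ^ 2) (by positivity)
    linarith
  have hcomb : w₁ * (X + η₁ * Y) ^ p + w₂ * (X + η₂ * Y) ^ p
      ≤ X ^ p + Z ^ p * ((1 + t) ^ p - 1 - p * t) := by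
    have h1 := mul_le_mul_of_nonneg_left (key η₁ hη₁) hw₁
    have h2 := mul_le_mul_of_nonneg_left (key η₂ hη₂) hw₂
    refine (add_le_add h1 h2).trans (le_of_eq ?_)
    linear_combination (X ^ p + Z ^ p * ((1 + t) ^ p - 1 - p * t)) * hw
      + p * X ^ (p - 1) * Y * hη
  refine hcomb.trans ?_
  have h1 : Z ^ p * ((1 + t) ^ p - 1 - p * t)
      ≤ Z ^ p * (Real.exp (p ^ 2 * s ^ 2 / L ^ 2) - 1) := by gcongr
  have h2 : Z ^ p * (Real.exp (p ^ 2 * s ^ 2 / L ^ 2) - 1)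
      ≤ (X ^ p + L ^ p * Y ^ p) * (Real.exp (p ^ 2 * s ^ 2 / L ^ 2) - 1) := by gcongr
  linarith

/-! ### Multilinear polynomials and their derivatives -/

section Multilinear

variable {n : ℕ}

/-- The derivative `∂_S` at `m` of the multilinear polynomial `∑ T, a T * ∏ i ∈ T, m i`. -/
noncomputable def multilinDeriv (a : Finset (Fin n) → ℝ) (S : Finset (Fin n)) (m : Fin n → ℝ) : ℝ :=
  ∑ T : Finset (Fin n), if S ⊆ T then a T * ∏ i ∈ T \ S, m i else 0

theorem multilinDeriv_empty (a : Finset (Fin n) → ℝ) (m : Fin n → ℝ) :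
    multilinDeriv a ∅ m = ∑ T : Finset (Fin n), a T * ∏ i ∈ T, m i := by
  simp [multilinDeriv]

theorem multilinDeriv_zero (a : Finset (Fin n) → ℝ) (S : Finset (Fin n)) :
    multilinDeriv a S 0 = a S := by
  unfold multilinDeriv
  rw [Finset.sum_eq_single S]
  · simp
  · intro T _ hTS
    split_ifs with h
    · have : (T \ S).Nonempty := by
        rw [Finset.sdiff_nonempty]
        exact fun h' => hTS (h'.antisymm h)
      obtain ⟨i, hi⟩ := this
      rw [Finset.prod_eq_zero hi (by simp), mul_zero]
    · rfl
  · simp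

theorem multilinDeriv_update_of_mem (a : Finset (Fin n) → ℝ) {S : Finset (Fin n)} {i : Fin n}
    (hi : i ∈ S) (m : Fin n → ℝ) (y : ℝ) :
    multilinDeriv a S (Function.update m i y) = multilinDeriv a S m := by
  unfold multilinDeriv
  refine Finset.sum_congr rfl fun T _ => ?_
  split_ifs with h
  · congr 1
    refine Finset.prod_congr rfl fun j hj => ?_
    rw [Function.update_of_ne]
    rintro rfl
    exact (Finset.mem_sdiff.1 hj).2 hi
  · rfl

/-- Affineness in coordinate i makes the first-order expansion exact. -/
theorem multilinDeriv_update_of_notMem (a : Finset (Fin n) → ℝ) {S : Finset (Fin n)} {i : Fin n}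
    (hi : i ∉ S) (m : Fin n → ℝ) (η : ℝ) :
    multilinDeriv a S (Function.update m i (m i + η))
      = multilinDeriv a S m + η * multilinDeriv a (insert i S) m := by
  unfold multilinDeriv
  rw [Finset.mul_sum, ← Finset.sum_add_distrib]
  refine Finset.sum_congr rfl fun T _ => ?_
  by_cases h : S ⊆ T
  · by_cases hiT : i ∈ T
    · have h' : insert i S ⊆ T := Finset.insert_subset hiT h
      have hins : T \ S = insert i (T \ insert i S) := by
        ext j
        simp only [Finset.mem_sdiff, Finset.mem_insert]
        by_cases hj : j = i
        · subst hj; simp [hiT, hi]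
        · simp [hj]
      have hni : i ∉ T \ insert i S := by simp
      rw [if_pos h, if_pos h, if_pos h', hins, Finset.prod_insert hni, Finset.prod_insert hni,
        Function.update_self]
      have : ∏ j ∈ T \ insert i S, Function.update m i (m i + η) j = ∏ j ∈ T \ insert i S, m j :=
        Finset.prod_congr rfl fun j hj => Function.update_of_ne (by rintro rfl; exact hni hj) _ _
      rw [this]
      ring
    · have h' : ¬ insert i S ⊆ T := fun h' => hiT (h' (Finset.mem_insert_self _ _))
      rw [if_pos h, if_pos h, if_neg h', mul_zero, add_zero]
      congr 1
      exact Finset.prod_congr rfl fun j hj =>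
        Function.update_of_ne (by rintro rfl; exact hiT (Finset.mem_sdiff.1 hj).1) _ _
  · have h' : ¬ insert i S ⊆ T := fun h' => h ((Finset.subset_insert _ _).trans h')
    simp [h, h']

/-- A weighted sum of the `p`-th powers of all derivatives of a multilinear polynomial. -/
noncomputable def derivPotential (p : ℕ) (L : ℝ) (a : Finset (Fin n) → ℝ) (m : Fin n → ℝ) : ℝ :=
  ∑ S : Finset (Fin n), L ^ (p * S.card) * multilinDeriv a S m ^ p

theorem derivPotential_nonneg {p : ℕ} (hp : Even p) {L : ℝ} (hL : 0 < L)
    (a : Finset (Fin n) → ℝ) (m : Fin n → ℝ) : 0 ≤ derivPotential p L a m :=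
  Finset.sum_nonneg fun _ _ => mul_nonneg (by positivity) (hp.pow_nonneg _)

theorem multilinDeriv_pow_le_derivPotential {p : ℕ} (hp : Even p) {L : ℝ} (hL : 0 < L)
    (a : Finset (Fin n) → ℝ) (S : Finset (Fin n)) (m : Fin n → ℝ) :
    L ^ (p * S.card) * multilinDeriv a S m ^ p ≤ derivPotential p L a m :=
  Finset.single_le_sum (f := fun S => L ^ (p * S.card) * multilinDeriv a S m ^ p)
    (fun _ _ => mul_nonneg (by positivity) (hp.pow_nonneg _)) (Finset.mem_univ S)

/-- A step in coordinate i mixes only the derivatives at S and at S ∪ {i}, so the potential is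
estimated pair by pair. -/
theorem sum_finset_eq_sum_insert (i : Fin n) (F : Finset (Fin n) → ℝ) :
    ∑ S : Finset (Fin n), F S
      = ∑ S ∈ (Finset.univ.erase i).powerset, (F S + F (insert i S)) := by
  rw [Finset.sum_add_distrib, ← Finset.sum_powerset_insert (Finset.notMem_erase i _),
    Finset.insert_erase (Finset.mem_univ i), Finset.powerset_univ]

/-- A mean-zero step in one coordinate increases the expected potential by a small factor. -/
theorem derivPotential_step {p : ℕ} (hp : Even p) {w₁ w₂ η₁ η₂ s L : ℝ}
    (hw₁ : 0 ≤ w₁) (hw₂ : 0 ≤ w₂) (hw : w₁ + w₂ = 1) (hη : w₁ * η₁ + w₂ * η₂ = 0)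
    (hη₁ : |η₁| ≤ s) (hη₂ : |η₂| ≤ s) (hL : 0 < L) (a : Finset (Fin n) → ℝ) (m : Fin n → ℝ)
    (i : Fin n) :
    w₁ * derivPotential p L a (Function.update m i (m i + η₁))
        + w₂ * derivPotential p L a (Function.update m i (m i + η₂))
      ≤ Real.exp (p ^ 2 * s ^ 2 / L ^ 2) * derivPotential p L a m := by
  unfold derivPotential
  simp only [sum_finset_eq_sum_insert i, Finset.mul_sum]
  rw [← Finset.sum_add_distrib]
  refine Finset.sum_le_sum fun S hS => ?_
  have hi : i ∉ S := fun h => by simpa using Finset.mem_powerset.1 hS h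
  simp only [multilinDeriv_update_of_mem a (Finset.mem_insert_self i S),
    multilinDeriv_update_of_notMem a hi, Finset.card_insert_of_notMem hi]
  have h := mul_le_mul_of_nonneg_left
    (two_point_moment_le hp (multilinDeriv a S m) (multilinDeriv a (insert i S) m)
      hw₁ hw₂ hw hη hη₁ hη₂ hL) (show 0 ≤ L ^ (p * S.card) by positivity)
  have e : L ^ (p * (S.card + 1)) = L ^ (p * S.card) * L ^ p := by rw [mul_add, mul_one, pow_add]
  rw [e]
  set E := Real.exp (p ^ 2 * s ^ 2 / L ^ 2)
  set M := L ^ (p * S.card)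
  set Y := multilinDeriv a (insert i S) m
  have e2 : w₁ * (M * L ^ p * Y ^ p) + w₂ * (M * L ^ p * Y ^ p) = M * L ^ p * Y ^ p := by
    rw [← add_mul, hw, one_mul]
  linarith

/-- Coefficients in `[-1, 1]` that vanish off the sets of size `l`. -/
def IsLevelCoeff (l : ℕ) (a : Finset (Fin n) → ℝ) : Prop :=
  (∀ S, |a S| ≤ 1) ∧ ∀ S, S.card ≠ l → a S = 0

theorem derivPotential_zero_le {p l : ℕ} (hp : Even p) (hp0 : p ≠ 0) {L : ℝ} (hL : 0 < L)
    {a : Finset (Fin n) → ℝ} (ha : IsLevelCoeff l a) :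
    derivPotential p L a 0 ≤ L ^ (p * l) * (n : ℝ) ^ l := by
  unfold derivPotential
  simp only [multilinDeriv_zero]
  calc ∑ S : Finset (Fin n), L ^ (p * S.card) * a S ^ p
      ≤ ∑ S : Finset (Fin n), if S ∈ Finset.powersetCard l Finset.univ then L ^ (p * l) else 0 := by
        refine Finset.sum_le_sum fun S _ => ?_
        by_cases h : S.card = l
        · rw [if_pos (by simp [h]), h, ← hp.pow_abs]
          have : |a S| ^ p ≤ 1 := pow_le_one₀ (abs_nonneg _) (ha.1 S)
          have hLp : 0 ≤ L ^ (p * l) := by positivity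
          nlinarith
        · rw [if_neg (by simp [h]), ha.2 S h, zero_pow hp0, mul_zero]
    _ = (n.choose l : ℝ) * L ^ (p * l) := by
        rw [← Finset.sum_filter, Finset.filter_mem_eq_inter, Finset.univ_inter, Finset.sum_const,
          Finset.card_powersetCard, Finset.card_univ, Fintype.card_fin, nsmul_eq_mul]
    _ ≤ L ^ (p * l) * (n : ℝ) ^ l := by
        rw [mul_comm]
        gcongr
        exact_mod_cast Nat.choose_le_pow n l

end Multilinear

/-! ### From signed sums to the level-`l` Fourier weight -/

section Cube

variable {n : ℕ}

/-- A point of the cube as a real vector. -/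
def Cube.toReal (x : Cube n) : Fin n → ℝ := fun i => ((x i : ℤ) : ℝ)

theorem Cube.parity_cast (S : Finset (Fin n)) (x : Cube n) :
    (((Cube.parity S x : ℤˣ) : ℤ) : ℝ) = ∏ i ∈ S, x.toReal i := by
  simp [Cube.parity, Cube.toReal, Units.coe_prod]

theorem Cube.toReal_sq (x : Cube n) (i : Fin n) : x.toReal i * x.toReal i = 1 := by
  rcases Int.units_eq_one_or (x i) with h | h <;> simp [Cube.toReal, h]

theorem Cube.prod_symmDiff (S T : Finset (Fin n)) (x : Cube n) :
    (∏ i ∈ S, x.toReal i) * ∏ i ∈ T, x.toReal i = ∏ i ∈ symmDiff S T, x.toReal i := by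
  have hdis : Disjoint (S \ T) (T \ S) := disjoint_sdiff_sdiff
  have h1 : ∏ i ∈ S, x.toReal i = (∏ i ∈ S \ T, x.toReal i) * ∏ i ∈ S ∩ T, x.toReal i := by
    rw [← Finset.prod_union (Finset.disjoint_sdiff_inter S T), Finset.sdiff_union_inter]
  have h2 : ∏ i ∈ T, x.toReal i = (∏ i ∈ T \ S, x.toReal i) * ∏ i ∈ S ∩ T, x.toReal i := by
    rw [Finset.inter_comm, ← Finset.prod_union (Finset.disjoint_sdiff_inter T S),
      Finset.sdiff_union_inter]
  have h3 : (∏ i ∈ S ∩ T, x.toReal i) * ∏ i ∈ S ∩ T, x.toReal i = 1 := by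
    rw [← Finset.prod_mul_distrib]
    exact Finset.prod_eq_one fun i _ => x.toReal_sq i
  have h4 : symmDiff S T = S \ T ∪ T \ S := rfl
  rw [h4, Finset.prod_union hdis, h1, h2]
  linear_combination ((∏ i ∈ S \ T, x.toReal i) * ∏ i ∈ T \ S, x.toReal i) * h3

/-- Sums of nontrivial characters vanish. -/
theorem Cube.sum_prod_toReal {S : Finset (Fin n)} (hS : S.Nonempty) :
    ∑ x : Cube n, ∏ i ∈ S, x.toReal i = 0 := by
  obtain ⟨i, hi⟩ := hS
  have hinv : Function.Involutive fun x : Cube n => Function.update x i (-x i) := by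
    intro x
    simp
  have h := Equiv.sum_comp (Function.Involutive.toPerm _ hinv) fun x : Cube n => ∏ j ∈ S, x.toReal j
  have h2 : ∀ x : Cube n, ∏ j ∈ S, Cube.toReal (Function.Involutive.toPerm _ hinv x) j = -∏ j ∈ S, x.toReal j := by
    intro x
    rw [← Finset.mul_prod_erase S _ hi, ← Finset.mul_prod_erase S _ hi]
    have : ∏ j ∈ S.erase i, Cube.toReal (Function.Involutive.toPerm _ hinv x) j = ∏ j ∈ S.erase i, x.toReal j := by
      refine Finset.prod_congr rfl fun j hj => ?_
      simp [Cube.toReal, Function.Involutive.toPerm, Function.update_of_ne (Finset.ne_of_mem_erase hj)]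
    rw [this]
    simp [Cube.toReal, Function.Involutive.toPerm]
  simp only [h2, Finset.sum_neg_distrib] at h
  linarith

/-- The level-`l` Fourier weight of an average of functions is at most any bound on their
correlations with the multilinear polynomials with level-`l` coefficients. -/
theorem levelL1_integral_le {Ω : Type*} [MeasurableSpace Ω] (μ : Measure Ω)
    [IsProbabilityMeasure μ] (F : Ω → Cube n → ℝ) (hF : ∀ x, Integrable (fun ω => F ω x) μ)
    (l : ℕ) (B : ℝ)
    (h : ∀ᵐ ω ∂μ, ∀ a : Finset (Fin n) → ℝ, IsLevelCoeff l a →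
      ∑ x : Cube n, F ω x * multilinDeriv a ∅ x.toReal ≤ 2 ^ n * B) :
    levelL1 l (fun x => ∫ ω, F ω x ∂μ) ≤ B := by
  set f : Cube n → ℝ := fun x => ∫ ω, F ω x ∂μ with hf
  -- The dual witness: the signs of the averaged function, hence one polynomial for all ω.
  set a : Finset (Fin n) → ℝ := fun S =>
    if S.card = l then (SignType.sign (cubeFourierCoeff f S) : ℝ) else 0 with ha
  have hal : IsLevelCoeff l a := by
    refine ⟨fun S => ?_, fun S hS => by simp [ha, hS]⟩
    simp only [ha]
    split_ifs
    · rcases lt_trichotomy (cubeFourierCoeff f S) 0 with h | h | h <;> simp [h]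
    · simp
  have e1 : levelL1 l f = (∑ x : Cube n, f x * multilinDeriv a ∅ x.toReal) / 2 ^ n := by
    have : ∀ x : Cube n, f x * multilinDeriv a ∅ x.toReal
        = ∑ S : Finset (Fin n), a S * (f x * ∏ i ∈ S, x.toReal i) := by
      intro x
      rw [multilinDeriv_empty, Finset.mul_sum]
      exact Finset.sum_congr rfl fun S _ => by ring
    simp only [this]
    rw [Finset.sum_comm, Finset.sum_div]
    unfold levelL1
    rw [← Finset.sum_subset (Finset.subset_univ (Finset.powersetCard l Finset.univ))]
    · refine Finset.sum_congr rfl fun S hS => ?_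
      have hS' : S.card = l := by simpa using hS
      rw [← Finset.mul_sum, mul_div_assoc]
      have : (∑ x : Cube n, f x * ∏ i ∈ S, x.toReal i) / 2 ^ n = cubeFourierCoeff f S := by
        simp only [cubeFourierCoeff, Cube.parity_cast]
      rw [this, ha]
      simp [hS']
    · intro S _ hS
      have hS' : S.card ≠ l := by simpa using hS
      simp [ha, hS']
  have e2 : ∑ x : Cube n, f x * multilinDeriv a ∅ x.toReal
      = ∫ ω, ∑ x : Cube n, F ω x * multilinDeriv a ∅ x.toReal ∂μ := by
    rw [integral_finsetSum _ fun x _ => (hF x).mul_const _]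
    exact Finset.sum_congr rfl fun x _ => (integral_mul_const _ _).symm
  have e3 : ∫ ω, ∑ x : Cube n, F ω x * multilinDeriv a ∅ x.toReal ∂μ ≤ 2 ^ n * B := by
    calc _ ≤ ∫ _, 2 ^ n * B ∂μ := by
          refine integral_mono_ae (integrable_finsetSum _ fun x _ => (hF x).mul_const _)
            (integrable_const _) ?_
          filter_upwards [h] with ω hω using hω a hal
      _ = 2 ^ n * B := by simp
  rw [e1, e2, div_le_iff₀ (by positivity)]
  linarith

/-- A replacement for Cauchy–Schwarz that is linear in the second moment, so that it can be summed
over the leaves; R is optimised at the end. -/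
theorem abs_le_add_sq_div {R X : ℝ} (hR : 0 < R) : |X| ≤ R + 1 / R * X ^ 2 := by
  rw [← sq_abs X]
  have h : |X| * R ≤ (R + 1 / R * |X| ^ 2) * R := by
    have : (R + 1 / R * |X| ^ 2) * R = R ^ 2 + |X| ^ 2 := by field_simp
    rw [this]
    nlinarith [sq_nonneg (R - |X|), abs_nonneg X, sq_nonneg (R + |X|)]
  exact le_of_mul_le_mul_right h hR

/-- With p above log n, the number of level-`l` monomials contributes only 2^l after a p-th root. -/
theorem pow_log_le_two_pow {n : ℕ} (l : ℕ) {p : ℕ} (hp : Nat.log 2 n + 1 ≤ p) :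
    (n : ℝ) ^ l ≤ (2 ^ l) ^ p := by
  have h1 : n ≤ 2 ^ p :=
    (Nat.lt_pow_succ_log_self (by norm_num) n).le.trans (Nat.pow_le_pow_right (by norm_num) hp)
  have h2 : (n : ℝ) ≤ 2 ^ p := by exact_mod_cast h1
  calc (n : ℝ) ^ l ≤ (2 ^ p) ^ l := by gcongr
    _ = (2 ^ l) ^ p := by rw [← pow_mul, ← pow_mul, mul_comm]

end Cube

/-! ### Noisy decision trees -/

section Posterior

/-- Bayes' rule for a ±1 bit of mean m: the answer +1 of a query of correlation γ has probability (1
+ γm)/2 and leads to the mean (m + γ)/(1 + γm). The answer -1 is the case of -γ. -/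
theorem posterior_spec {γ m : ℝ} (hγ : |γ| ≤ 1) (hm : |m| ≤ 1) :
    0 ≤ 1 + γ * m ∧ (1 + γ * m) * ((m + γ) / (1 + γ * m)) = m + γ ∧
      |(m + γ) / (1 + γ * m)| ≤ 1 ∧ |(m + γ) / (1 + γ * m) - m| ≤ 2 * |γ| := by
  have hγm : |γ * m| ≤ 1 := by rw [abs_mul]; exact mul_le_one₀ hγ (abs_nonneg _) hm
  have h0 : 0 ≤ 1 + γ * m := by linarith [(abs_le.1 hγm).1]
  obtain ⟨g1, g2⟩ := abs_le.1 hγ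
  obtain ⟨m1, m2⟩ := abs_le.1 hm
  -- An answer of probability zero forces m = -γ. The quotient is then 0 by convention, and the
  -- bounds still hold.
  rcases h0.eq_or_lt with h | h
  · have hsum : m + γ = 0 := by
      have : (m + γ) ^ 2 = 0 := by
        refine le_antisymm ?_ (sq_nonneg _)
        nlinarith
      simpa using this
    have hmγ : m = -γ := by linarith
    refine ⟨h0, ?_, ?_, ?_⟩
    · rw [hsum]; simp
    · rw [hsum]; simp
    · rw [hsum, hmγ]
      simp only [zero_div, zero_sub, neg_neg]
      linarith [abs_nonneg γ]
  · refine ⟨h0, by field_simp, ?_, ?_⟩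
    · rw [abs_div, abs_of_pos h, div_le_one h, abs_le]
      constructor <;> nlinarith
    · have e : (m + γ) / (1 + γ * m) - m = γ * (1 - m ^ 2) / (1 + γ * m) := by
        rw [eq_div_iff h.ne', sub_mul, div_mul_cancel₀ _ h.ne']
        ring
      have h3 : 0 ≤ 1 - m ^ 2 := by nlinarith
      rw [e, abs_div, abs_of_pos h, div_le_iff₀ h, abs_mul, abs_of_nonneg h3]
      -- Hence 1 + γm ≥ 1 - |m|, while 1 - m² ≤ 2(1 - |m|); the factor 2 comes from here.
      have h1 : |γ * m| ≤ |m| := by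
        rw [abs_mul]; exact mul_le_of_le_one_left (abs_nonneg _) hγ
      have h2 : 1 - m ^ 2 ≤ 2 * (1 + γ * m) := by
        rw [← sq_abs m]
        nlinarith [(abs_le.1 h1).1, abs_nonneg m]
      nlinarith [abs_nonneg γ]

end Posterior

namespace NoisyTree

variable {n : ℕ}

theorem cost_nonneg (T : NoisyTree n) : 0 ≤ T.cost := by
  induction T with
  | leaf b => simp [cost]
  | node q γ pos neg ihp ihn =>
    exact add_nonneg (sq_nonneg _) (ihp.trans (le_max_left _ _))

theorem noisyQueryProb_one (γ : ℝ) (x : Cube n) (q : Fin n) :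
    noisyQueryProb γ (x q) 1 = (1 + γ * x.toReal q) / 2 := by
  rcases Int.units_eq_one_or (x q) with h | h
  · simp [noisyQueryProb, Cube.toReal, h]
  · have : (1 : ℤˣ) ≠ -1 := by decide
    simp [noisyQueryProb, Cube.toReal, h, this]
    ring

theorem noisyQueryProb_neg_one (γ : ℝ) (x : Cube n) (q : Fin n) :
    noisyQueryProb γ (x q) (-1) = (1 + (-γ) * x.toReal q) / 2 := by
  rcases Int.units_eq_one_or (x q) with h | h
  · have : (-1 : ℤˣ) ≠ 1 := by decide
    simp [noisyQueryProb, Cube.toReal, h, this]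
    ring
  · simp [noisyQueryProb, Cube.toReal, h]

theorem acceptProb_mem_Icc (T : NoisyTree n) (x : Cube n) : T.acceptProb x ∈ Set.Icc (0 : ℝ) 1 := by
  induction T with
  | leaf b => cases b <;> simp [acceptProb]
  | node q γ pos neg ihp ihn =>
    obtain ⟨γ, h1, h2⟩ := γ
    rw [Set.mem_Icc] at ihp ihn ⊢
    simp only [acceptProb, noisyQueryProb_one, noisyQueryProb_neg_one]
    rcases Int.units_eq_one_or (x q) with h | h <;> simp only [Cube.toReal, h] <;> push_cast <;>
      constructor <;> nlinarith

/-- Conditioning product-like moments on the outcome of a noisy query. -/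
theorem sum_posterior {γ : ℝ} (hγ : |γ| ≤ 1) {g : Cube n → ℝ} {m : Fin n → ℝ} {G : ℝ}
    (hm : ∀ i, |m i| ≤ 1)
    (hg : ∀ S : Finset (Fin n), ∑ x : Cube n, g x * ∏ i ∈ S, x.toReal i = G * ∏ i ∈ S, m i)
    (q : Fin n) (S : Finset (Fin n)) :
    ∑ x : Cube n, (g x * ((1 + γ * x.toReal q) / 2)) * ∏ i ∈ S, x.toReal i
      = (G * ((1 + γ * m q) / 2)) *
        ∏ i ∈ S, Function.update m q ((m q + γ) / (1 + γ * m q)) i := by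
  have hspec := (posterior_spec hγ (hm q)).2.1
  have e : ∀ x : Cube n, (g x * ((1 + γ * x.toReal q) / 2)) * ∏ i ∈ S, x.toReal i
      = 1 / 2 * (g x * ∏ i ∈ S, x.toReal i)
        + γ / 2 * (g x * (x.toReal q * ∏ i ∈ S, x.toReal i)) := fun x => by ring
  simp only [e, Finset.sum_add_distrib, ← Finset.mul_sum, hg]
  by_cases hq : q ∈ S
  · have e2 : ∀ x : Cube n, x.toReal q * ∏ i ∈ S, x.toReal i = ∏ i ∈ S.erase q, x.toReal i := by
      intro x
      rw [← Finset.mul_prod_erase S _ hq, ← mul_assoc, x.toReal_sq, one_mul]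
    simp only [e2, hg]
    rw [← Finset.mul_prod_erase S _ hq, ← Finset.mul_prod_erase S _ hq, Function.update_self]
    have e3 : ∏ i ∈ S.erase q, Function.update m q ((m q + γ) / (1 + γ * m q)) i
        = ∏ i ∈ S.erase q, m i :=
      Finset.prod_congr rfl fun i hi => Function.update_of_ne (Finset.ne_of_mem_erase hi) _ _
    rw [e3]
    linear_combination (-(G * ∏ i ∈ S.erase q, m i) / 2) * hspec
  · have e2 : ∀ x : Cube n, x.toReal q * ∏ i ∈ S, x.toReal i = ∏ i ∈ insert q S, x.toReal i :=
      fun x => (Finset.prod_insert hq).symm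
    simp only [e2, hg]
    rw [Finset.prod_insert hq]
    have e3 : ∏ i ∈ S, Function.update m q ((m q + γ) / (1 + γ * m q)) i = ∏ i ∈ S, m i :=
      Finset.prod_congr rfl fun i hi => Function.update_of_ne (by rintro rfl; exact hq hi) _ _
    rw [e3]
    ring

set_option maxHeartbeats 1000000 in
/-- The correlation of a noisy tree with a multilinear polynomial, for weights `g` with the moments
of a product distribution of mean `m`. -/
theorem abs_sum_acceptProb_mul_le {p : ℕ} (hp : Even p) {L A B R : ℝ} (hL : 0 < L)
    (hA : 0 ≤ A) (hB : 0 ≤ B) (hR : 0 < R) (a : Finset (Fin n) → ℝ)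
    (hAB : ∀ (m : Fin n → ℝ) (i : Fin n),
      multilinDeriv a {i} m ^ 2 ≤ A + B * derivPotential p L a m)
    (T : NoisyTree n) (g : Cube n → ℝ) (hg0 : ∀ x, 0 ≤ g x) (m : Fin n → ℝ)
    (hm : ∀ i, |m i| ≤ 1) (G : ℝ)
    (hg : ∀ S : Finset (Fin n), ∑ x : Cube n, g x * ∏ i ∈ S, x.toReal i = G * ∏ i ∈ S, m i)
    (c : ℝ) (hc : T.cost ≤ c) :
    |∑ x : Cube n, g x * T.acceptProb x * multilinDeriv a ∅ x.toReal|
      ≤ G * (R + 1 / R * (multilinDeriv a ∅ m ^ 2 + 4 * c *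
        (A + B * (Real.exp (4 * p ^ 2 / L ^ 2 * c) * derivPotential p L a m)))) := by
  induction T generalizing g m G c with
  | leaf b =>
    have hc0 : 0 ≤ c := by simpa [cost] using hc
    have hG : 0 ≤ G := by
      have := hg ∅
      simp only [Finset.prod_empty, mul_one] at this
      rw [← this]
      exact Finset.sum_nonneg fun x _ => hg0 x
    have e : ∑ x : Cube n, g x * multilinDeriv a ∅ x.toReal = G * multilinDeriv a ∅ m := by
      simp only [multilinDeriv_empty, Finset.mul_sum]
      rw [Finset.sum_comm]
      refine Finset.sum_congr rfl fun S _ => ?_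
      have : ∀ x : Cube n, g x * (a S * ∏ i ∈ S, x.toReal i)
          = a S * (g x * ∏ i ∈ S, x.toReal i) := fun x => by ring
      simp only [this, ← Finset.mul_sum, hg]
      ring
    have hW := derivPotential_nonneg hp hL a m
    have h1 : |∑ x : Cube n, g x * (leaf b : NoisyTree n).acceptProb x
        * multilinDeriv a ∅ x.toReal| ≤ G * |multilinDeriv a ∅ m| := by
      cases b
      · simp [acceptProb]
        positivity
      · simp only [acceptProb, if_true, mul_one]
        rw [e, abs_mul, abs_of_nonneg hG]
    refine h1.trans (mul_le_mul_of_nonneg_left ?_ hG)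
    refine (abs_le_add_sq_div hR).trans ?_
    gcongr
    have : 0 ≤ 4 * c * (A + B * (Real.exp (4 * p ^ 2 / L ^ 2 * c) * derivPotential p L a m)) := by
      positivity
    linarith
  | node q γ pos neg ihp ihn =>
    obtain ⟨γ, hγ'⟩ := γ
    have hγ : |γ| ≤ 1 := abs_le.2 hγ'
    have hγn : |-γ| ≤ 1 := by rwa [abs_neg]
    simp only [cost] at hc
    -- Both subtrees are charged the same remaining budget, so that their bounds can be averaged.
    have hcp : pos.cost ≤ c - γ ^ 2 := by linarith [le_max_left pos.cost neg.cost]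
    have hcn : neg.cost ≤ c - γ ^ 2 := by linarith [le_max_right pos.cost neg.cost]
    have hc' : 0 ≤ c - γ ^ 2 := pos.cost_nonneg.trans hcp
    have hG : 0 ≤ G := by
      have := hg ∅
      simp only [Finset.prod_empty, mul_one] at this
      rw [← this]
      exact Finset.sum_nonneg fun x _ => hg0 x
    obtain ⟨w0, wspec, wabs, wη⟩ := posterior_spec hγ (hm q)
    obtain ⟨v0, vspec, vabs, vη⟩ := posterior_spec hγn (hm q)
    have hprob : ∀ (δ : ℝ), |δ| ≤ 1 → ∀ x : Cube n, 0 ≤ g x * ((1 + δ * x.toReal q) / 2) := by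
      intro δ hδ x
      have hδ' := abs_le.1 hδ
      refine mul_nonneg (hg0 x) ?_
      rcases Int.units_eq_one_or (x q) with h | h <;> simp [Cube.toReal, h] <;> linarith
    have hupd : ∀ y : ℝ, |y| ≤ 1 → ∀ i, |Function.update m q y i| ≤ 1 := by
      intro y hy i
      by_cases h : i = q
      · subst h; simpa using hy
      · rw [Function.update_of_ne h]; exact hm i
    have ip := ihp _ (hprob γ hγ) _ (hupd _ wabs) _ (fun S => sum_posterior hγ hm hg q S) _ hcp
    have inn := ihn _ (hprob (-γ) hγn) _ (hupd _ vabs) _ (fun S => sum_posterior hγn hm hg q S) _ hcn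
    set η₁ := (m q + γ) / (1 + γ * m q) - m q with hη₁
    set η₂ := (m q + -γ) / (1 + -γ * m q) - m q with hη₂
    have u1 : (m q + γ) / (1 + γ * m q) = m q + η₁ := by rw [hη₁]; ring
    have u2 : (m q + -γ) / (1 + -γ * m q) = m q + η₂ := by rw [hη₂]; ring
    rw [u1] at ip wspec
    rw [u2] at inn vspec
    set w₁ := (1 + γ * m q) / 2 with hw₁
    set w₂ := (1 + -γ * m q) / 2 with hw₂
    have hw1 : 0 ≤ w₁ := by rw [hw₁]; linarith
    have hw2 : 0 ≤ w₂ := by rw [hw₂]; linarith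
    have hw : w₁ + w₂ = 1 := by rw [hw₁, hw₂]; ring
    have hη : w₁ * η₁ + w₂ * η₂ = 0 := by
      rw [hw₁, hw₂]
      linear_combination wspec / 2 + vspec / 2
    rw [abs_neg] at vη
    have hstep := derivPotential_step hp hw1 hw2 hw hη wη vη hL a m q
    have eκ : (p : ℝ) ^ 2 * (2 * |γ|) ^ 2 / L ^ 2 = 4 * p ^ 2 / L ^ 2 * γ ^ 2 := by
      rw [mul_pow, sq_abs]; ring
    rw [eκ] at hstep
    simp only [multilinDeriv_update_of_notMem a (Finset.notMem_empty q)] at ip inn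
    set κ := 4 * (p : ℝ) ^ 2 / L ^ 2 with hκ
    have hκ0 : 0 ≤ κ := by positivity
    set W := derivPotential p L a m with hWdef
    have hW : 0 ≤ W := derivPotential_nonneg hp hL a m
    set W₁ := derivPotential p L a (Function.update m q (m q + η₁))
    set W₂ := derivPotential p L a (Function.update m q (m q + η₂))
    set X := multilinDeriv a ∅ m
    have hY : multilinDeriv a (insert q ∅) m ^ 2 ≤ A + B * W := hAB m q
    set Y := multilinDeriv a (insert q ∅) m
    have esum : ∑ x : Cube n, g x * (node q ⟨γ, hγ'⟩ pos neg).acceptProb x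
          * multilinDeriv a ∅ x.toReal
        = ∑ x : Cube n, g x * ((1 + γ * x.toReal q) / 2) * pos.acceptProb x
            * multilinDeriv a ∅ x.toReal
          + ∑ x : Cube n, g x * ((1 + -γ * x.toReal q) / 2) * neg.acceptProb x
            * multilinDeriv a ∅ x.toReal := by
      rw [← Finset.sum_add_distrib]
      refine Finset.sum_congr rfl fun x _ => ?_
      simp only [acceptProb, noisyQueryProb_one, noisyQueryProb_neg_one]
      ring
    rw [esum]
    refine (abs_add_le _ _).trans ((add_le_add ip inn).trans ?_)
    set E := Real.exp (κ * (c - γ ^ 2)) with hE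
    have hEc : E * Real.exp (κ * γ ^ 2) = Real.exp (κ * c) := by
      rw [hE, ← Real.exp_add]; congr 1; ring
    have hE1 : 1 ≤ Real.exp (κ * c) := Real.one_le_exp (mul_nonneg hκ0 (by linarith [sq_nonneg γ]))
    have hη2 : w₁ * η₁ ^ 2 + w₂ * η₂ ^ 2 ≤ 4 * γ ^ 2 := by
      have s1 : η₁ ^ 2 ≤ 4 * γ ^ 2 := by
        have := pow_le_pow_left₀ (abs_nonneg _) wη 2
        rw [sq_abs, mul_pow, sq_abs] at this; linarith
      have s2 : η₂ ^ 2 ≤ 4 * γ ^ 2 := by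
        have := pow_le_pow_left₀ (abs_nonneg _) vη 2
        rw [sq_abs, mul_pow, sq_abs] at this; linarith
      calc _ ≤ w₁ * (4 * γ ^ 2) + w₂ * (4 * γ ^ 2) := by gcongr
        _ = 4 * γ ^ 2 := by rw [← add_mul, hw, one_mul]
    -- Orthogonality of martingale increments: the cross term vanishes.
    have hX2 : w₁ * (X + η₁ * Y) ^ 2 + w₂ * (X + η₂ * Y) ^ 2 ≤ X ^ 2 + 4 * γ ^ 2 * (A + B * W) := by
      have e : w₁ * (X + η₁ * Y) ^ 2 + w₂ * (X + η₂ * Y) ^ 2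
          = X ^ 2 + (w₁ * η₁ ^ 2 + w₂ * η₂ ^ 2) * Y ^ 2 := by
        linear_combination X ^ 2 * hw + 2 * X * Y * hη
      rw [e]
      have := mul_le_mul hη2 hY (sq_nonneg Y) (by positivity)
      linarith
    have hWs : B * (E * (w₁ * W₁ + w₂ * W₂)) ≤ B * (Real.exp (κ * c) * W) := by
      rw [← hEc, mul_assoc]
      gcongr
    have hWc : B * W ≤ B * (Real.exp (κ * c) * W) := by
      gcongr
      exact le_mul_of_one_le_left hW hE1
    -- The increase of the second moment is paid for by the part 4γ² of the budget 4c, and the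
    -- growth of the potential by the part κγ² of the exponent.
    have hfin : (w₁ * (X + η₁ * Y) ^ 2 + w₂ * (X + η₂ * Y) ^ 2)
        + 4 * (c - γ ^ 2) * (A + B * (E * (w₁ * W₁ + w₂ * W₂)))
        ≤ X ^ 2 + 4 * c * (A + B * (Real.exp (κ * c) * W)) := by
      have t1 : 4 * (c - γ ^ 2) * (A + B * (E * (w₁ * W₁ + w₂ * W₂)))
          ≤ 4 * (c - γ ^ 2) * (A + B * (Real.exp (κ * c) * W)) := by gcongr
      have t2 : 4 * γ ^ 2 * (A + B * W) ≤ 4 * γ ^ 2 * (A + B * (Real.exp (κ * c) * W)) := by gcongr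
      linarith
    have hcomb : G * w₁ * (R + 1 / R * ((X + η₁ * Y) ^ 2 + 4 * (c - γ ^ 2) * (A + B * (E * W₁))))
        + G * w₂ * (R + 1 / R * ((X + η₂ * Y) ^ 2 + 4 * (c - γ ^ 2) * (A + B * (E * W₂))))
        = G * (R + 1 / R * ((w₁ * (X + η₁ * Y) ^ 2 + w₂ * (X + η₂ * Y) ^ 2)
        + 4 * (c - γ ^ 2) * (A + B * (E * (w₁ * W₁ + w₂ * W₂))))) := by
      generalize 1 / R = ρ
      linear_combination (G * R + G * ρ * (4 * (c - γ ^ 2) * A)) * hw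
    rw [hcomb]
    gcongr

end NoisyTree

/-- Bounds y by a typical size A plus a high moment, linearly in that moment; this takes the place
of a p-th root of an expectation. -/
theorem le_add_mul_div_pow {A y : ℝ} (hA : 0 < A) (hy : 0 ≤ y) {q : ℕ} (hq : q ≠ 0) :
    y ≤ A + A * (y / A) ^ q := by
  rcases le_total y A with h | h
  · have : 0 ≤ A * (y / A) ^ q := by positivity
    linarith
  · have h1 : 1 ≤ y / A := (one_le_div hA).2 h
    have h2 : A * (y / A) ≤ A * (y / A) ^ q := by
      gcongr
      exact le_self_pow₀ h1 hq
    rw [mul_div_cancel₀ _ hA.ne'] at h2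
    linarith

theorem exp_natCast_le_three_pow (p : ℕ) : Real.exp p ≤ 3 ^ p := by
  rw [← mul_one (p : ℝ), Real.exp_nat_mul]
  gcongr
  linarith [Real.exp_one_lt_d9]

theorem natLog_le_logb {n : ℕ} (hn : 2 ≤ n) :
    1 ≤ Real.logb 2 n ∧ ((2 * (Nat.log 2 n + 1) : ℕ) : ℝ) ≤ 4 * Real.logb 2 n := by
  have h1 : (1 : ℝ) ≤ Real.logb 2 n := by
    rw [Real.le_logb_iff_rpow_le (by norm_num) (by positivity)]
    simpa using hn
  have h2 : (Nat.log 2 n : ℝ) ≤ Real.logb 2 n := by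
    simpa using Real.natLog_le_logb n 2
  refine ⟨h1, ?_⟩
  push_cast
  linarith

theorem noisy_bound_le {n l : ℕ} (hl : 1 ≤ l) (hln : l ≤ n) {δ : ℝ} (hδ : 0 < δ) :
    2 * (√(8 * δ) * (6 ^ l * √(4 * (2 * (Nat.log 2 n + 1) : ℕ) * δ) ^ (l - 1)))
      ≤ (20736 * δ) ^ ((l : ℝ) / 2) * (l * Real.logb 2 n) ^ (((l : ℝ) - 1) / 2) := by
  have hlog : 0 ≤ Real.logb 2 n :=
    Real.logb_nonneg (by norm_num) (by exact_mod_cast hl.trans hln)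
  have e1 : (20736 * δ) ^ ((l : ℝ) / 2) = (144 * √δ) ^ l := by
    rw [show (20736 : ℝ) * δ = (144 * √δ) ^ 2 by
      rw [mul_pow, Real.sq_sqrt hδ.le]; norm_num, ← Real.rpow_natCast _ 2,
      ← Real.rpow_mul (by positivity), ← Real.rpow_natCast]
    congr 1
    push_cast
    ring
  have e2 : (l * Real.logb 2 n) ^ (((l : ℝ) - 1) / 2) = √(l * Real.logb 2 n) ^ (l - 1) := by
    rw [Real.sqrt_eq_rpow, ← Real.rpow_natCast, ← Real.rpow_mul (by positivity)]
    congr 1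
    push_cast [Nat.cast_sub hl]
    ring
  have h8 : √(8 * δ) ≤ 3 * √δ := by
    rw [← Real.sqrt_sq (show (0 : ℝ) ≤ 3 by norm_num), ← Real.sqrt_mul (by norm_num)]
    apply Real.sqrt_le_sqrt
    linarith
  have hp : √(4 * (2 * (Nat.log 2 n + 1) : ℕ) * δ) ^ (l - 1)
      ≤ (4 * √δ * √(l * Real.logb 2 n)) ^ (l - 1) := by
    -- For l = 1 the logarithm appears with exponent 0, which covers n = 1; otherwise n ≥ 2 and log
    -- n ≥ 1.
    rcases hl.eq_or_lt with rfl | h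
    · simp
    · have hn : 2 ≤ n := by omega
      obtain ⟨h1, h2⟩ := natLog_le_logb hn
      gcongr
      have hl' : (1 : ℝ) ≤ l := by exact_mod_cast hl
      have : Real.logb 2 n ≤ l * Real.logb 2 n := le_mul_of_one_le_left hlog hl'
      refine Real.sqrt_le_iff.2 ⟨by positivity, ?_⟩
      rw [mul_pow, mul_pow, Real.sq_sqrt hδ.le, Real.sq_sqrt (by positivity)]
      nlinarith
  rw [e1, e2]
  obtain ⟨k, rfl⟩ : ∃ k, l = k + 1 := ⟨l - 1, by omega⟩
  simp only [Nat.add_sub_cancel] at hp ⊢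
  set M := √(((k + 1 : ℕ) : ℝ) * Real.logb 2 n)
  calc _ ≤ 2 * (3 * √δ * (6 ^ (k + 1) * (4 * √δ * M) ^ k)) := by gcongr
    _ = 36 * 24 ^ k * (√δ ^ (k + 1) * M ^ k) := by
      rw [mul_pow, mul_pow, show (24 : ℝ) = 6 * 4 by norm_num, mul_pow]; ring
    _ ≤ 144 ^ (k + 1) * (√δ ^ (k + 1) * M ^ k) := by
      have : (36 : ℝ) * 24 ^ k ≤ 144 * 144 ^ k := by gcongr <;> norm_num
      rw [pow_succ (144 : ℝ), mul_comm _ (144 : ℝ)]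
      gcongr
    _ = _ := by rw [mul_pow]; ring

namespace NoisyTree

variable {n : ℕ}

theorem sum_acceptProb_mul_le (T : NoisyTree n) {l : ℕ} (hl : 1 ≤ l) {δ : ℝ} (hδ : 0 < δ)
    (hT : T.cost ≤ δ) {a : Finset (Fin n) → ℝ} (ha : IsLevelCoeff l a) :
    ∑ x : Cube n, T.acceptProb x * multilinDeriv a ∅ x.toReal
      ≤ 2 ^ n * (2 * (√(8 * δ) *
        (6 ^ l * √(4 * (2 * (Nat.log 2 n + 1) : ℕ) * δ) ^ (l - 1)))) := by
  set q := Nat.log 2 n + 1 with hq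
  have hq0 : q ≠ 0 := by omega
  have hp : Even (2 * q) := even_two_mul q
  have hppos : (0 : ℝ) < (2 * q : ℕ) := by exact_mod_cast (by omega : 0 < 2 * q)
  -- Makes the growth exponent 4p²δ/L² equal to p = 2q.
  set L := √(4 * (2 * q : ℕ) * δ) with hLdef
  have hL : 0 < L := Real.sqrt_pos.2 (by positivity)
  have hL2 : L ^ 2 = 4 * (2 * q : ℕ) * δ := Real.sq_sqrt (by positivity)
  -- The typical size of a first derivative: e^p Φ(0) ≤ 3^p (2L)^(lp) ≤ (L H)^p.
  set H := 6 ^ l * L ^ (l - 1) with hH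
  have hHpos : 0 < H := by positivity
  have hAB : ∀ (m : Fin n → ℝ) (i : Fin n), multilinDeriv a {i} m ^ 2
      ≤ H ^ 2 + H ^ 2 / (L ^ (2 * q) * H ^ (2 * q)) * derivPotential (2 * q) L a m := by
    intro m i
    refine (le_add_mul_div_pow (pow_pos hHpos 2) (sq_nonneg _) hq0).trans ?_
    have h := multilinDeriv_pow_le_derivPotential hp hL a {i} m
    rw [Finset.card_singleton, mul_one] at h
    rw [div_pow, ← pow_mul, ← pow_mul]
    have : H ^ 2 * (multilinDeriv a {i} m ^ (2 * q) / H ^ (2 * q))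
        = H ^ 2 / (L ^ (2 * q) * H ^ (2 * q)) * (L ^ (2 * q) * multilinDeriv a {i} m ^ (2 * q)) := by
      field_simp
    rw [this]
    gcongr
  -- R² = 4δ(H² + H²) is the resulting bound on the second moment of P.
  have hR : 0 < √(8 * δ) * H := mul_pos (Real.sqrt_pos.2 (by positivity)) hHpos
  have key := abs_sum_acceptProb_mul_le hp hL (sq_nonneg H) (by positivity) hR a hAB T
    (fun _ => 1) (fun _ => zero_le_one) 0 (by simp) (2 ^ n) (by
      intro S
      rcases S.eq_empty_or_nonempty with rfl | hS
      · simp [Cube]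
      · obtain ⟨i, hi⟩ := hS
        rw [Finset.prod_eq_zero hi (by simp)]
        simpa using Cube.sum_prod_toReal ⟨i, hi⟩) δ hT
  simp only [one_mul] at key
  refine (le_abs_self _).trans (key.trans ?_)
  have h0 : multilinDeriv a ∅ 0 = 0 := by
    rw [multilinDeriv_zero]
    exact ha.2 ∅ (by simp; omega)
  have hκ : 4 * ((2 * q : ℕ) : ℝ) ^ 2 / L ^ 2 * δ = (2 * q : ℕ) := by
    rw [hL2]; field_simp
  rw [h0, hκ]
  have hW : H ^ 2 / (L ^ (2 * q) * H ^ (2 * q))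
      * (Real.exp (2 * q : ℕ) * derivPotential (2 * q) L a 0) ≤ H ^ 2 := by
    rw [div_mul_eq_mul_div, div_le_iff₀ (by positivity)]
    refine mul_le_mul_of_nonneg_left ?_ (sq_nonneg H)
    calc Real.exp (2 * q : ℕ) * derivPotential (2 * q) L a 0
        ≤ 3 ^ (2 * q) * (L ^ (2 * q * l) * (2 ^ l) ^ (2 * q)) := by
          gcongr
          · exact derivPotential_nonneg hp hL a 0
          · exact exp_natCast_le_three_pow _
          · refine (derivPotential_zero_le hp (by omega) hL ha).trans ?_
            gcongr
            exact pow_log_le_two_pow l (by omega)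
      _ ≤ (3 ^ l) ^ (2 * q) * (L ^ (2 * q * l) * (2 ^ l) ^ (2 * q)) := by
          gcongr
          exact le_self_pow₀ (by norm_num) (by omega)
      _ = L ^ (2 * q) * H ^ (2 * q) := by
          obtain ⟨k, rfl⟩ : ∃ k, l = k + 1 := ⟨l - 1, by omega⟩
          simp only [Nat.add_sub_cancel] at hH
          rw [hH, ← mul_pow, mul_comm (2 * q) (k + 1), pow_mul L (k + 1), ← mul_pow, ← mul_pow]
          congr 1
          rw [show (6 : ℝ) = 3 * 2 by norm_num, mul_pow]
          ring
  gcongr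
  have hR2 : (√(8 * δ) * H) ^ 2 = 8 * δ * H ^ 2 := by
    rw [mul_pow, Real.sq_sqrt (by positivity)]
  set R := √(8 * δ) * H
  have h4 : (0 : ℝ) ^ 2 + 4 * δ * (H ^ 2 + H ^ 2 / (L ^ (2 * q) * H ^ (2 * q))
      * (Real.exp (2 * q : ℕ) * derivPotential (2 * q) L a 0)) ≤ R ^ 2 := by
    rw [hR2]
    nlinarith
  calc _ ≤ R + 1 / R * R ^ 2 := by gcongr
    _ = 2 * R := by field_simp; ring

end NoisyTree

theorem RandomizedNoisyTree.levelL1_toFun_le {n : ℕ} {d : ℝ} (R : RandomizedNoisyTree n d) {l : ℕ}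
    (hl : 1 ≤ l) (hln : l ≤ n) :
    levelL1 l R.toFun
      ≤ (20736 * d) ^ ((l : ℝ) / 2) * (l * Real.logb 2 n) ^ (((l : ℝ) - 1) / 2) := by
  let _ := R.sigmaAlgebra
  have := R.isProbabilityMeasure
  have hd : 0 ≤ d := by
    obtain ⟨T, hT⟩ := R.cost_le.exists
    exact T.cost_nonneg.trans hT
  have hint : ∀ x : Cube n, Integrable (fun T : NoisyTree n => T.acceptProb x) R.law := fun x =>
    Integrable.of_mem_Icc 0 1 (R.measurable_acceptProb x).aemeasurable
      (Filter.Eventually.of_forall fun T => T.acceptProb_mem_Icc x)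
  -- A strictly larger δ keeps L and R positive when d = 0; the limit δ → d is taken by continuity.
  have h : ∀ δ > d, levelL1 l R.toFun
      ≤ (20736 * δ) ^ ((l : ℝ) / 2) * (l * Real.logb 2 n) ^ (((l : ℝ) - 1) / 2) := by
    intro δ hδ
    have hδ0 : 0 < δ := hd.trans_lt hδ
    refine (levelL1_integral_le R.law _ hint l _ ?_).trans (noisy_bound_le hl hln hδ0)
    filter_upwards [R.cost_le] with T hT a ha
    exact T.sum_acceptProb_mul_le hl hδ0 (hT.trans hδ.le) ha
  have hcont : Continuous fun δ : ℝ =>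
      (20736 * δ) ^ ((l : ℝ) / 2) * (l * Real.logb 2 n) ^ (((l : ℝ) - 1) / 2) :=
    ((continuous_const.mul continuous_id).rpow_const fun _ => Or.inr (by positivity)).mul_const _
  exact ge_of_tendsto (hcont.continuousWithinAt (s := Set.Ioi d) (x := d))
    (Filter.eventually_of_mem self_mem_nhdsWithin h)

/-! ### Parity decision trees -/

/-! ### Low-degree tests and weights that look unbiased to them -/

section LowDegree

variable {n : ℕ}

/-- The functions on the cube of Fourier degree at most `k`. -/
def lowDegree (n k : ℕ) : Submodule ℝ (Cube n → ℝ) :=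
  Submodule.span ℝ {F | ∃ S : Finset (Fin n), S.card ≤ k ∧ F = fun x => ∏ i ∈ S, x.toReal i}

theorem prod_mem_lowDegree {k : ℕ} {S : Finset (Fin n)} (hS : S.card ≤ k) :
    (fun x : Cube n => ∏ i ∈ S, x.toReal i) ∈ lowDegree n k :=
  Submodule.subset_span ⟨S, hS, rfl⟩

theorem mul_mem_lowDegree {j k : ℕ} {F F' : Cube n → ℝ} (hF : F ∈ lowDegree n j)
    (hF' : F' ∈ lowDegree n k) : F * F' ∈ lowDegree n (j + k) := by
  induction hF using Submodule.span_induction with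
  | zero => rw [zero_mul]; exact zero_mem _
  | add F₁ F₂ _ _ h₁ h₂ => rw [add_mul]; exact add_mem h₁ h₂
  | smul c F₁ _ h₁ => rw [smul_mul_assoc]; exact Submodule.smul_mem _ c h₁
  | mem F₁ h₁ =>
    obtain ⟨S, hS, rfl⟩ := h₁
    induction hF' using Submodule.span_induction with
    | zero => rw [mul_zero]; exact zero_mem _
    | add F₁ F₂ _ _ h₁ h₂ => rw [mul_add]; exact add_mem h₁ h₂
    | smul c F₁ _ h₁ => rw [mul_smul_comm]; exact Submodule.smul_mem _ c h₁
    | mem F₁ h₁ =>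
      obtain ⟨T, hT, rfl⟩ := h₁
      have e : (fun x : Cube n => ∏ i ∈ S, x.toReal i) * (fun x : Cube n => ∏ i ∈ T, x.toReal i)
          = fun x => ∏ i ∈ symmDiff S T, x.toReal i :=
        funext fun x => Cube.prod_symmDiff S T x
      rw [e]
      refine prod_mem_lowDegree ?_
      calc (symmDiff S T).card ≤ (S ∪ T).card := Finset.card_le_card symmDiff_le_sup
        _ ≤ S.card + T.card := Finset.card_union_le _ _
        _ ≤ j + k := add_le_add hS hT

theorem pow_mem_lowDegree {k : ℕ} {F : Cube n → ℝ} (hF : F ∈ lowDegree n k) (p : ℕ) :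
    F ^ p ∈ lowDegree n (k * p) := by
  induction p with
  | zero =>
    have := prod_mem_lowDegree (n := n) (k := k * 0) (S := ∅) (by simp)
    simp only [Finset.prod_empty] at this
    exact this
  | succ p ih => rw [pow_succ, mul_add, mul_one]; exact mul_mem_lowDegree ih hF

/-- The coordinates in `I` of a point of the cube, the others being set to `0`. -/
def Cube.restrict (I : Finset (Fin n)) (x : Cube n) : Fin n → ℝ :=
  fun i => if i ∈ I then x.toReal i else 0

/-- Every derivative has degree at most `l` and is raised to the power p. This is why clean sets are
used with K = lp. -/
theorem derivPotential_restrict_mem_lowDegree {l : ℕ} {a : Finset (Fin n) → ℝ}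
    (ha : IsLevelCoeff l a) (p : ℕ) (L : ℝ) (I : Finset (Fin n)) :
    (fun x : Cube n => derivPotential p L a (x.restrict I)) ∈ lowDegree n (l * p) := by
  have hD : ∀ S : Finset (Fin n),
      (fun x : Cube n => multilinDeriv a S (x.restrict I)) ∈ lowDegree n l := by
    intro S
    have e : (fun x : Cube n => multilinDeriv a S (x.restrict I)) = ∑ T : Finset (Fin n),
        fun x : Cube n => if S ⊆ T then a T * ∏ i ∈ T \ S, x.restrict I i else 0 := by
      ext x
      simp [multilinDeriv]
    rw [e]
    refine Submodule.sum_mem _ fun T _ => ?_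
    split_ifs with hST
    · by_cases hTl : T.card = l
      · by_cases hI : T \ S ⊆ I
        · have e2 : (fun x : Cube n => a T * ∏ i ∈ T \ S, x.restrict I i)
              = a T • fun x : Cube n => ∏ i ∈ T \ S, x.toReal i := by
            ext x
            rw [Pi.smul_apply, smul_eq_mul]
            congr 1
            exact Finset.prod_congr rfl fun i hi => if_pos (hI hi)
          rw [e2]
          exact Submodule.smul_mem _ _
            (prod_mem_lowDegree ((Finset.card_le_card Finset.sdiff_subset).trans hTl.le))
        · obtain ⟨i, hi, hiI⟩ := Finset.not_subset.1 hI
          have e2 : (fun x : Cube n => a T * ∏ i ∈ T \ S, x.restrict I i) = 0 := by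
            ext x
            rw [Finset.prod_eq_zero hi (if_neg hiI)]
            simp
          rw [e2]
          exact zero_mem _
      · have e2 : (fun x : Cube n => a T * ∏ i ∈ T \ S, x.restrict I i) = 0 := by
          ext x
          simp [ha.2 T hTl]
        rw [e2]
        exact zero_mem _
    · exact zero_mem _
  have e : (fun x : Cube n => derivPotential p L a (x.restrict I)) = ∑ S : Finset (Fin n),
      L ^ (p * S.card) • (fun x : Cube n => multilinDeriv a S (x.restrict I)) ^ p := by
    ext x
    simp [derivPotential]
  rw [e]
  exact Submodule.sum_mem _ fun S _ => Submodule.smul_mem _ _ (pow_mem_lowDegree (hD S) p)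

/-- The weights `g` do not see parities with at least one and at most `K` coordinates
outside `J`. -/
def UnbiasedOff (K : ℕ) (J : Finset (Fin n)) (g : Cube n → ℝ) : Prop :=
  ∀ S : Finset (Fin n), ¬ S ⊆ J → (S \ J).card ≤ K → ∑ x : Cube n, g x * ∏ i ∈ S, x.toReal i = 0

/-- By linearity only monomials of degree at most K matter: those containing i have zero sum on both
sides, the others do not depend on x_i. -/
theorem UnbiasedOff.sum_eq_sum_average {K : ℕ} {J : Finset (Fin n)} {g : Cube n → ℝ}
    (hg : UnbiasedOff K J g) {i : Fin n} (hi : i ∉ J) {F : Cube n → ℝ} (hF : F ∈ lowDegree n K) :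
    ∑ x, g x * F x
      = ∑ x, g x * ((F (Function.update x i 1) + F (Function.update x i (-1))) / 2) := by
  induction hF using Submodule.span_induction with
  | zero => simp
  | add F₁ F₂ _ _ h₁ h₂ =>
    simp only [Pi.add_apply, mul_add, Finset.sum_add_distrib, h₁, h₂]
    rw [← Finset.sum_add_distrib]
    exact Finset.sum_congr rfl fun x _ => by ring
  | smul c F₁ _ h₁ =>
    have e1 : ∀ x, g x * (c • F₁) x = c * (g x * F₁ x) := fun x => by
      simp only [Pi.smul_apply, smul_eq_mul]; ring
    have e2 : ∀ x, g x * (((c • F₁) (Function.update x i 1)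
        + (c • F₁) (Function.update x i (-1))) / 2)
        = c * (g x * ((F₁ (Function.update x i 1) + F₁ (Function.update x i (-1))) / 2)) :=
      fun x => by simp only [Pi.smul_apply, smul_eq_mul]; ring
    simp only [e1, e2, ← Finset.mul_sum, h₁]
  | mem F₁ h₁ =>
    obtain ⟨S, hS, rfl⟩ := h₁
    by_cases hiS : i ∈ S
    · rw [hg S (fun h => hi (h hiS)) ((Finset.card_le_card Finset.sdiff_subset).trans hS)]
      refine (Finset.sum_eq_zero fun x _ => ?_).symm
      have e : ∀ b : ℤˣ, ∏ j ∈ S, Cube.toReal (Function.update x i b) j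
          = ((b : ℤ) : ℝ) * ∏ j ∈ S.erase i, x.toReal j := by
        intro b
        rw [← Finset.mul_prod_erase S _ hiS]
        congr 1
        · simp [Cube.toReal]
        · exact Finset.prod_congr rfl fun j hj => by
            simp [Cube.toReal, Function.update_of_ne (Finset.ne_of_mem_erase hj)]
      simp [e]
    · have e : ∀ (x : Cube n) (b : ℤˣ), ∏ j ∈ S, Cube.toReal (Function.update x i b) j
          = ∏ j ∈ S, x.toReal j := fun x b =>
        Finset.prod_congr rfl fun j hj => by
          have : j ≠ i := by rintro rfl; exact hiS hj
          simp [Cube.toReal, Function.update_of_ne this]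
      simp [e]

/-- Revealing further coordinates, which look independent to low-degree tests, increases the
expected potential by a bounded factor for each of them. -/
theorem UnbiasedOff.sum_derivPotential_le {p l : ℕ} (hp : Even p) {L : ℝ} (hL : 0 < L)
    {a : Finset (Fin n) → ℝ} (ha : IsLevelCoeff l a) {J : Finset (Fin n)} {g : Cube n → ℝ}
    (hg0 : ∀ x, 0 ≤ g x) (hg : UnbiasedOff (l * p) J g) {I : Finset (Fin n)} (hI : Disjoint I J) :
    ∑ x : Cube n, g x * derivPotential p L a (x.restrict (J ∪ I))
      ≤ Real.exp (p ^ 2 / L ^ 2 * I.card)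
        * ∑ x : Cube n, g x * derivPotential p L a (x.restrict J) := by
  induction I using Finset.induction_on with
  | empty => simp
  | insert i I hiI ih =>
    have hiJ : i ∉ J := Finset.disjoint_left.1 hI (Finset.mem_insert_self i I)
    have ih' := ih (hI.mono_left (Finset.subset_insert i I))
    rw [hg.sum_eq_sum_average hiJ (derivPotential_restrict_mem_lowDegree ha p L _)]
    have hi : i ∉ J ∪ I := by simp [hiJ, hiI]
    have hstep : ∀ x : Cube n,
        (derivPotential p L a (Cube.restrict (J ∪ insert i I) (Function.update x i 1))
          + derivPotential p L a (Cube.restrict (J ∪ insert i I) (Function.update x i (-1)))) / 2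
        ≤ Real.exp (p ^ 2 / L ^ 2) * derivPotential p L a (x.restrict (J ∪ I)) := by
      intro x
      -- Unrevealed coordinates have mean 0, so revealing one is a fair ±1 step.
      have e : ∀ b : ℤˣ, Cube.restrict (J ∪ insert i I) (Function.update x i b)
          = Function.update (x.restrict (J ∪ I)) i (x.restrict (J ∪ I) i + ((b : ℤ) : ℝ)) := by
        intro b
        ext j
        by_cases hj : j = i
        · subst hj
          have h0 : x.restrict (J ∪ I) j = 0 := if_neg hi
          rw [Function.update_self, h0]
          simp [Cube.restrict, Cube.toReal]
        · rw [Function.update_of_ne hj]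
          simp [Cube.restrict, Cube.toReal, hj]
      have h := derivPotential_step (w₁ := 1 / 2) (w₂ := 1 / 2) (η₁ := 1) (η₂ := -1) (s := 1) hp
        (by norm_num) (by norm_num) (by norm_num) (by norm_num) (by norm_num) (by norm_num) hL a
        (x.restrict (J ∪ I)) i
      rw [e, e]
      rw [one_pow, mul_one] at h
      push_cast
      linarith
    calc _ ≤ ∑ x : Cube n, g x
            * (Real.exp (p ^ 2 / L ^ 2) * derivPotential p L a (x.restrict (J ∪ I))) :=
          Finset.sum_le_sum fun x _ => mul_le_mul_of_nonneg_left (hstep x) (hg0 x)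
      _ = Real.exp (p ^ 2 / L ^ 2)
            * ∑ x : Cube n, g x * derivPotential p L a (x.restrict (J ∪ I)) := by
          rw [Finset.mul_sum]
          exact Finset.sum_congr rfl fun x _ => by ring
      _ ≤ Real.exp (p ^ 2 / L ^ 2) * (Real.exp (p ^ 2 / L ^ 2 * I.card)
            * ∑ x : Cube n, g x * derivPotential p L a (x.restrict J)) := by gcongr
      _ = _ := by
          rw [← mul_assoc, ← Real.exp_add, Finset.card_insert_of_notMem hiI]
          congr 2
          push_cast
          ring

end LowDegree

/-! ### Known parities, clean sets and the induction over the tree -/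

namespace ParityTree

variable {n : ℕ}

theorem indicatorVec_symmDiff (S T : Finset (Fin n)) :
    indicatorVec (symmDiff S T) = indicatorVec S + indicatorVec T := by
  ext i
  have h2 : (1 : ZMod 2) + 1 = 0 := by decide
  by_cases hS : i ∈ S <;> by_cases hT : i ∈ T <;>
    simp [indicatorVec, Finset.mem_symmDiff, hS, hT, h2]

theorem indicatorVec_eq_zero {S : Finset (Fin n)} (h : indicatorVec S = 0) : S = ∅ := by
  refine Finset.eq_empty_of_forall_notMem fun i hi => ?_
  have := congrFun h i
  simp [indicatorVec, hi] at this

/-- The vectors in `U` that are supported in `I`. -/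
def supportedIn (U : Submodule (ZMod 2) (Fin n → ZMod 2)) (I : Finset (Fin n)) :
    Submodule (ZMod 2) (Fin n → ZMod 2) where
  carrier := {v | v ∈ U ∧ ∀ i, i ∉ I → v i = 0}
  zero_mem' := ⟨zero_mem _, fun _ _ => rfl⟩
  add_mem' := fun h₁ h₂ => ⟨add_mem h₁.1 h₂.1, fun i hi => by
    rw [Pi.add_apply, h₁.2 i hi, h₂.2 i hi, add_zero]⟩
  smul_mem' := fun c _ h => ⟨U.smul_mem c h.1, fun i hi => by
    rw [Pi.smul_apply, h.2 i hi, smul_zero]⟩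

theorem supportedIn_mono {U U' : Submodule (ZMod 2) (Fin n → ZMod 2)} (hU : U ≤ U')
    {I I' : Finset (Fin n)} (hI : I ⊆ I') : supportedIn U I ≤ supportedIn U' I' :=
  fun _ hv => ⟨hU hv.1, fun i hi => hv.2 i fun h => hi (hI h)⟩

theorem supportedIn_le (U : Submodule (ZMod 2) (Fin n → ZMod 2)) (I : Finset (Fin n)) :
    supportedIn U I ≤ U := fun _ hv => hv.1

/-- Every known parity with at most `K` coordinates outside `J` lies inside `J`. -/
def IsClean (K : ℕ) (U : Submodule (ZMod 2) (Fin n → ZMod 2)) (J : Finset (Fin n)) : Prop :=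
  ∀ S : Finset (Fin n), indicatorVec S ∈ U → (S \ J).card ≤ K → S ⊆ J

/-- A set of coordinates can be enlarged to a clean one, with `K` coordinates per dimension. -/
theorem exists_isClean (K : ℕ) (U : Submodule (ZMod 2) (Fin n → ZMod 2)) (J : Finset (Fin n))
    (hJ : J.card ≤ K * Module.finrank (ZMod 2) (supportedIn U J)) :
    ∃ I, J ⊆ I ∧ I.card ≤ K * Module.finrank (ZMod 2) (supportedIn U I) ∧ IsClean K U I := by
  set C := (Finset.univ : Finset (Finset (Fin n))).filter fun I =>
    J ⊆ I ∧ I.card ≤ K * Module.finrank (ZMod 2) (supportedIn U I) with hC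
  -- A largest admissible set is clean: adjoining a violating S would add at most K coordinates and
  -- raise the dimension of the known parities inside by at least one.
  obtain ⟨I, hI, hmax⟩ := C.exists_max_image Finset.card ⟨J, by simp [hC, hJ]⟩
  have hI' : J ⊆ I ∧ I.card ≤ K * Module.finrank (ZMod 2) (supportedIn U I) := by
    simpa [hC] using hI
  refine ⟨I, hI'.1, hI'.2, ?_⟩
  intro S hSU hSK
  by_contra hSI
  have hlt : supportedIn U I < supportedIn U (I ∪ S) := by
    refine lt_of_le_of_ne (supportedIn_mono le_rfl Finset.subset_union_left) fun heq => ?_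
    have hmem : indicatorVec S ∈ supportedIn U (I ∪ S) := ⟨hSU, fun i hi => by
      have : i ∉ S := fun h => hi (Finset.mem_union_right _ h)
      simp [indicatorVec, this]⟩
    rw [← heq] at hmem
    obtain ⟨i, hiS, hiI⟩ := Finset.not_subset.1 hSI
    have := hmem.2 i hiI
    simp [indicatorVec, hiS] at this
  have hfr := Submodule.finrank_lt_finrank_of_lt hlt
  have hcard : (I ∪ S).card = I.card + (S \ I).card := by
    rw [← Finset.union_sdiff_self_eq_union, Finset.card_union_of_disjoint Finset.disjoint_sdiff]
  have hmem : I ∪ S ∈ C := by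
    simp only [hC, Finset.mem_filter, Finset.mem_univ, true_and]
    refine ⟨hI'.1.trans Finset.subset_union_left, ?_⟩
    calc (I ∪ S).card ≤ K * Module.finrank (ZMod 2) (supportedIn U I) + K := by
          rw [hcard]; exact add_le_add hI'.2 hSK
      _ = K * (Module.finrank (ZMod 2) (supportedIn U I) + 1) := by ring
      _ ≤ _ := Nat.mul_le_mul_left K hfr
  have h1 := hmax _ hmem
  have h2 : 0 < (S \ I).card := Finset.card_pos.2 (Finset.sdiff_nonempty.2 hSI)
  omega

/-- The weights `g` have their Fourier support in `U`. -/
def FourierSupportedIn (U : Submodule (ZMod 2) (Fin n → ZMod 2)) (g : Cube n → ℝ) : Prop :=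
  ∀ S : Finset (Fin n), indicatorVec S ∉ U → ∑ x : Cube n, g x * ∏ i ∈ S, x.toReal i = 0

theorem FourierSupportedIn.unbiasedOff {K : ℕ} {U : Submodule (ZMod 2) (Fin n → ZMod 2)}
    {g : Cube n → ℝ} (hg : FourierSupportedIn U g) {J : Finset (Fin n)} (hJ : IsClean K U J) :
    UnbiasedOff K J g :=
  fun S hS hK => hg S fun h => hS (hJ S h hK)

/-- Conditioning on the outcome of a query `Q` adds `Q` to the Fourier support. -/
theorem FourierSupportedIn.query {U U' : Submodule (ZMod 2) (Fin n → ZMod 2)} (hU : U ≤ U')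
    {g : Cube n → ℝ} (hg : FourierSupportedIn U g) {Q : Finset (Fin n)}
    (hQ : indicatorVec Q ∈ U') (c : ℝ) :
    FourierSupportedIn U' fun x => g x * ((1 + c * ∏ i ∈ Q, x.toReal i) / 2) := by
  intro S hS
  have e : ∀ x : Cube n, g x * ((1 + c * ∏ i ∈ Q, x.toReal i) / 2) * ∏ i ∈ S, x.toReal i
      = 1 / 2 * (g x * ∏ i ∈ S, x.toReal i)
        + c / 2 * (g x * ∏ i ∈ symmDiff Q S, x.toReal i) := fun x => by
    rw [← Cube.prod_symmDiff]; ring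
  have hQS : indicatorVec (symmDiff Q S) ∉ U := fun h => hS <| by
    rw [indicatorVec_symmDiff] at h
    exact (Submodule.add_mem_iff_right _ hQ).1 (hU h)
  simp only [e, Finset.sum_add_distrib, ← Finset.mul_sum, hg S fun h => hS (hU h), hg _ hQS]
  ring

/-- Monomials of P not contained in J have degree l ≤ K and average to zero under g, so at a leaf
only the revealed coordinates count. -/
theorem sum_mul_multilinDeriv_eq_restrict {K l : ℕ} (hlK : l ≤ K) {a : Finset (Fin n) → ℝ}
    (ha : IsLevelCoeff l a) {J : Finset (Fin n)} {g : Cube n → ℝ} (hg : UnbiasedOff K J g) :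
    ∑ x : Cube n, g x * multilinDeriv a ∅ x.toReal
      = ∑ x : Cube n, g x * multilinDeriv a ∅ (x.restrict J) := by
  simp only [multilinDeriv_empty, Finset.mul_sum]
  rw [Finset.sum_comm, Finset.sum_comm (s := Finset.univ (α := Cube n))]
  refine Finset.sum_congr rfl fun S _ => ?_
  by_cases hS : S.card = l
  · by_cases hSJ : S ⊆ J
    · refine Finset.sum_congr rfl fun x _ => ?_
      congr 2
      exact Finset.prod_congr rfl fun i hi => (if_pos (hSJ hi)).symm
    · have e : ∀ x : Cube n, g x * (a S * ∏ i ∈ S, x.toReal i)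
          = a S * (g x * ∏ i ∈ S, x.toReal i) := fun x => by ring
      simp only [e, ← Finset.mul_sum]
      rw [hg S hSJ ((Finset.card_le_card Finset.sdiff_subset).trans (hS.le.trans hlK)), mul_zero]
      obtain ⟨i, hi, hiJ⟩ := Finset.not_subset.1 hSJ
      refine (Finset.sum_eq_zero fun x _ => ?_).symm
      rw [Finset.prod_eq_zero hi (if_neg hiJ)]
      ring
  · simp [ha.2 S hS]

/-- The correlation of a parity tree with a level-`l` polynomial, for weights `g` supported on the
known parities `U`, when the coordinates in the clean set `J` have been revealed. -/
theorem abs_sum_eval_mul_le {p l : ℕ} (hp : Even p) (hp0 : p ≠ 0) {L R : ℝ} (hL : 0 < L)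
    (hR : 0 < R) {a : Finset (Fin n) → ℝ} (ha : IsLevelCoeff l a) (T : ParityTree n)
    (g : Cube n → ℝ) (hg0 : ∀ x, 0 ≤ g x) (U : Submodule (ZMod 2) (Fin n → ZMod 2))
    (hg : FourierSupportedIn U g) (J : Finset (Fin n)) (hJ : IsClean (l * p) U J)
    (hJU : J.card ≤ l * p * Module.finrank (ZMod 2) (supportedIn U J)) (D : ℝ)
    (hD : l * p * (Module.finrank (ZMod 2) U + T.depth : ℝ) ≤ D) :
    |∑ x : Cube n, g x * (if T.eval x = true then 1 else 0) * multilinDeriv a ∅ x.toReal|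
      ≤ R * ∑ x : Cube n, g x + R / R ^ p * (Real.exp (p ^ 2 / L ^ 2 * (D - J.card))
        * ∑ x : Cube n, g x * derivPotential p L a (x.restrict J)) := by
  induction T generalizing g U J with
  | leaf b =>
    have hunb := hg.unbiasedOff hJ
    have h1 : |∑ x : Cube n, g x * (if (leaf b : ParityTree n).eval x = true then 1 else 0)
        * multilinDeriv a ∅ x.toReal| ≤ |∑ x : Cube n, g x * multilinDeriv a ∅ x.toReal| := by
      cases b <;> simp [eval]
    -- The budget D for revealed coordinates is never exceeded, so the unused growth factor is at
    -- least 1.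
    have hJD : (J.card : ℝ) ≤ D := by
      have h2 : J.card ≤ l * p * Module.finrank (ZMod 2) U :=
        hJU.trans (Nat.mul_le_mul_left _ (Submodule.finrank_mono (supportedIn_le U J)))
      have h3 : (J.card : ℝ) ≤ l * p * Module.finrank (ZMod 2) U := by exact_mod_cast h2
      simp only [depth, Nat.cast_zero, add_zero] at hD
      linarith
    have hE : 1 ≤ Real.exp (p ^ 2 / L ^ 2 * (D - J.card)) :=
      Real.one_le_exp (mul_nonneg (by positivity) (by linarith))
    refine h1.trans ?_
    rw [sum_mul_multilinDeriv_eq_restrict (Nat.le_mul_of_pos_right l (by omega)) ha hunb]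
    refine (Finset.abs_sum_le_sum_abs _ _).trans ?_
    simp only [Finset.mul_sum]
    rw [← Finset.sum_add_distrib]
    refine Finset.sum_le_sum fun x _ => ?_
    rw [abs_mul, abs_of_nonneg (hg0 x)]
    have hW : multilinDeriv a ∅ (x.restrict J) ^ p ≤ derivPotential p L a (x.restrict J) := by
      simpa using multilinDeriv_pow_le_derivPotential hp hL a ∅ (x.restrict J)
    have hW0 := derivPotential_nonneg hp hL a (x.restrict J)
    have h4 := le_add_mul_div_pow hR (abs_nonneg (multilinDeriv a ∅ (x.restrict J))) hp0
    rw [div_pow, hp.pow_abs] at h4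
    have h5 : R * (multilinDeriv a ∅ (x.restrict J) ^ p / R ^ p)
        ≤ R / R ^ p * (Real.exp (p ^ 2 / L ^ 2 * (D - J.card))
          * derivPotential p L a (x.restrict J)) := by
      rw [mul_div_assoc', div_mul_eq_mul_div]
      gcongr
      exact hW.trans (le_mul_of_one_le_left hW0 hE)
    have h6 := mul_le_mul_of_nonneg_left (h4.trans (add_le_add_right h5 R)) (hg0 x)
    refine h6.trans (le_of_eq ?_)
    ring
  | node Q pos neg ihp ihn =>
    set U' := U ⊔ Submodule.span (ZMod 2) {indicatorVec Q} with hU'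
    have hUU' : U ≤ U' := le_sup_left
    have hQU' : indicatorVec Q ∈ U' :=
      Submodule.mem_sup_right (Submodule.mem_span_singleton_self _)
    have hfr : Module.finrank (ZMod 2) U' ≤ Module.finrank (ZMod 2) U + 1 :=
      (Submodule.finrank_add_le_finrank_add_finrank _ _).trans
        (Nat.add_le_add_left ((finrank_span_le_card _).trans (by simp)) _)
    -- The enlarged set depends on the query but not on its answer, so both subtrees share it.
    obtain ⟨J', hJJ', hJU', hJ'⟩ := exists_isClean (l * p) U' J
      (hJU.trans (Nat.mul_le_mul_left _ (Submodule.finrank_mono (supportedIn_mono hUU' le_rfl))))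
    have hdepth : ∀ T' : ParityTree n, T'.depth ≤ max pos.depth neg.depth →
        (l * p * (Module.finrank (ZMod 2) U' + T'.depth : ℝ)) ≤ D := by
      intro T' hT'
      refine le_trans ?_ hD
      have h : Module.finrank (ZMod 2) U' + T'.depth
          ≤ Module.finrank (ZMod 2) U + (node Q pos neg).depth := by
        simp only [depth]
        omega
      refine mul_le_mul_of_nonneg_left ?_ (by positivity)
      exact_mod_cast h
    have hχ : ∀ x : Cube n, ((Cube.parity Q x : ℤˣ) = 1 ∧ ∏ i ∈ Q, x.toReal i = 1) ∨
        ((Cube.parity Q x : ℤˣ) ≠ 1 ∧ ∏ i ∈ Q, x.toReal i = -1) := by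
      intro x
      rw [← Cube.parity_cast]
      rcases Int.units_eq_one_or (Cube.parity Q x) with h | h
      · left; simp [h]
      · right; rw [h]; exact ⟨by decide, by simp⟩
    have hg' : ∀ c : ℝ, |c| ≤ 1 → ∀ x : Cube n,
        0 ≤ g x * ((1 + c * ∏ i ∈ Q, x.toReal i) / 2) := by
      intro c hc x
      have hc' := abs_le.1 hc
      refine mul_nonneg (hg0 x) ?_
      rcases hχ x with h | h <;> rw [h.2] <;> linarith
    have ip := ihp _ (hg' 1 (by norm_num)) U' (hg.query hUU' hQU' 1) J' hJ' hJU'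
      (hdepth pos (le_max_left _ _))
    have inn := ihn _ (hg' (-1) (by norm_num)) U' (hg.query hUU' hQU' (-1)) J' hJ' hJU'
      (hdepth neg (le_max_right _ _))
    have esum : ∑ x : Cube n, g x * (if (node Q pos neg).eval x = true then 1 else 0)
          * multilinDeriv a ∅ x.toReal
        = ∑ x : Cube n, g x * ((1 + 1 * ∏ i ∈ Q, x.toReal i) / 2)
            * (if pos.eval x = true then 1 else 0) * multilinDeriv a ∅ x.toReal
          + ∑ x : Cube n, g x * ((1 + -1 * ∏ i ∈ Q, x.toReal i) / 2)
            * (if neg.eval x = true then 1 else 0) * multilinDeriv a ∅ x.toReal := by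
      rw [← Finset.sum_add_distrib]
      refine Finset.sum_congr rfl fun x _ => ?_
      rcases hχ x with ⟨h1, h2⟩ | ⟨h1, h2⟩
      · simp only [eval, h1, h2, if_true]; ring
      · simp only [eval, h1, h2, if_false]; ring
    have eadd : ∀ F : Cube n → ℝ,
        ∑ x : Cube n, g x * ((1 + 1 * ∏ i ∈ Q, x.toReal i) / 2) * F x
          + ∑ x : Cube n, g x * ((1 + -1 * ∏ i ∈ Q, x.toReal i) / 2) * F x
        = ∑ x : Cube n, g x * F x := by
      intro F
      rw [← Finset.sum_add_distrib]
      exact Finset.sum_congr rfl fun x _ => by ring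
    have eadd1 : ∑ x : Cube n, g x * ((1 + 1 * ∏ i ∈ Q, x.toReal i) / 2)
          + ∑ x : Cube n, g x * ((1 + -1 * ∏ i ∈ Q, x.toReal i) / 2) = ∑ x : Cube n, g x := by
      simpa using eadd fun _ => 1
    -- The coordinates of J' \ J are revealed before the answer to Q: under the unsplit weights g,
    -- for which J is clean, they still look unbiased. The answer then merely splits the sum.
    have hrev := (hg.unbiasedOff hJ).sum_derivPotential_le hp hL ha hg0
      (I := J' \ J) Finset.sdiff_disjoint
    rw [Finset.union_sdiff_of_subset hJJ', Finset.cast_card_sdiff hJJ'] at hrev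
    rw [esum]
    refine (abs_add_le _ _).trans ((add_le_add ip inn).trans ?_)
    calc _ = R * ∑ x : Cube n, g x + R / R ^ p * (Real.exp (p ^ 2 / L ^ 2 * (D - J'.card))
            * ∑ x : Cube n, g x * derivPotential p L a (x.restrict J')) := by
          rw [← eadd1, ← eadd fun x => derivPotential p L a (x.restrict J')]
          ring
      _ ≤ R * ∑ x : Cube n, g x + R / R ^ p * (Real.exp (p ^ 2 / L ^ 2 * (D - J'.card))
            * (Real.exp (p ^ 2 / L ^ 2 * (J'.card - J.card))
              * ∑ x : Cube n, g x * derivPotential p L a (x.restrict J))) := by gcongr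
      _ = _ := by
          rw [← mul_assoc (Real.exp _) (Real.exp _), ← Real.exp_add, ← mul_add]
          congr 5
          ring

theorem sum_eval_mul_le (T : ParityTree n) {l : ℕ} (hl : 1 ≤ l) {δ : ℝ} (hδ : 0 < δ)
    (hT : (T.depth : ℝ) ≤ δ) {a : Finset (Fin n) → ℝ} (ha : IsLevelCoeff l a) :
    ∑ x : Cube n, (if T.eval x = true then 1 else 0) * multilinDeriv a ∅ x.toReal
      ≤ 2 ^ n * (2 * (6 * √(l * δ) * (2 * (Nat.log 2 n + 1) : ℕ)) ^ l) := by
  set q := Nat.log 2 n + 1 with hq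
  have hp : Even (2 * q) := even_two_mul q
  have hp0 : 2 * q ≠ 0 := by omega
  have hppos : (0 : ℝ) < (2 * q : ℕ) := by exact_mod_cast (by omega : 0 < 2 * q)
  have hlpos : (0 : ℝ) < l := by exact_mod_cast hl
  -- With p = 2q, p²/L² = 1/(lδ), so revealing lpδ coordinates costs a factor e^p in total.
  set L := √(l * δ) * (2 * q : ℕ) with hLdef
  have hL : 0 < L := mul_pos (Real.sqrt_pos.2 (by positivity)) hppos
  have hL2 : L ^ 2 = l * δ * (2 * q : ℕ) ^ 2 := by
    rw [hLdef, mul_pow, Real.sq_sqrt (by positivity)]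
  -- R = (6L)^l satisfies e^p Φ(0) ≤ 3^p (2L)^(lp) ≤ R^p.
  have hR : 0 < (6 * L) ^ l := by positivity
  have hclean : IsClean (l * (2 * q)) (⊥ : Submodule (ZMod 2) (Fin n → ZMod 2)) ∅ := by
    intro S hS _
    rw [indicatorVec_eq_zero ((Submodule.mem_bot _).1 hS)]
  have hsupp : FourierSupportedIn (⊥ : Submodule (ZMod 2) (Fin n → ZMod 2))
      (fun _ : Cube n => (1 : ℝ)) := by
    intro S hS
    have hne : S.Nonempty := by
      rw [Finset.nonempty_iff_ne_empty]
      rintro rfl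
      exact hS ((Submodule.mem_bot _).2 (funext fun i => by simp [indicatorVec]))
    simpa using Cube.sum_prod_toReal hne
  have key := abs_sum_eval_mul_le hp hp0 hL hR ha T (fun _ => 1) (fun _ => zero_le_one) ⊥ hsupp ∅
    hclean (by simp) (l * (2 * q : ℕ) * δ) (by
      rw [finrank_bot, Nat.cast_zero, zero_add]
      gcongr)
  have hrestr : ∀ x : Cube n, x.restrict ∅ = 0 := fun x => by
    ext i
    simp [Cube.restrict]
  have hκ : ((2 * q : ℕ) : ℝ) ^ 2 / L ^ 2 * (l * (2 * q : ℕ) * δ - (∅ : Finset (Fin n)).card)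
      = (2 * q : ℕ) := by
    rw [hL2, Finset.card_empty, Nat.cast_zero, sub_zero]
    field_simp
  have hcard : ∑ _x : Cube n, (1 : ℝ) = 2 ^ n := by simp [Cube]
  rw [hκ] at key
  simp only [one_mul, hrestr, hcard, Finset.sum_const, Finset.card_univ, nsmul_eq_mul] at key
  have hcard' : ((Fintype.card (Cube n) : ℕ) : ℝ) = 2 ^ n := by simp [Cube]
  rw [hcard'] at key
  refine (le_abs_self _).trans (key.trans ?_)
  have hW : Real.exp (2 * q : ℕ) * derivPotential (2 * q) L a 0 ≤ ((6 * L) ^ l) ^ (2 * q) := by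
    calc Real.exp (2 * q : ℕ) * derivPotential (2 * q) L a 0
        ≤ 3 ^ (2 * q) * (L ^ (2 * q * l) * (2 ^ l) ^ (2 * q)) := by
          gcongr
          · exact derivPotential_nonneg hp hL a 0
          · exact exp_natCast_le_three_pow _
          · refine (derivPotential_zero_le hp hp0 hL ha).trans ?_
            gcongr
            exact pow_log_le_two_pow l (by omega)
      _ ≤ (3 ^ l) ^ (2 * q) * (L ^ (2 * q * l) * (2 ^ l) ^ (2 * q)) := by
          gcongr
          exact le_self_pow₀ (by norm_num) (by omega)
      _ = ((6 * L) ^ l) ^ (2 * q) := by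
          rw [mul_comm (2 * q) l, pow_mul L l, ← mul_pow, ← mul_pow, mul_pow 6 L,
            show (6 : ℝ) ^ l = 3 ^ l * 2 ^ l by rw [← mul_pow]; norm_num,
            show (3 : ℝ) ^ l * (L ^ l * 2 ^ l) = 3 ^ l * 2 ^ l * L ^ l by ring]
  have eL : 6 * √(l * δ) * ((2 * q : ℕ) : ℝ) = 6 * L := by rw [hLdef]; ring
  rw [eL]
  set R := (6 * L) ^ l
  calc _ = 2 ^ n * (R + R / R ^ (2 * q)
          * (Real.exp (2 * q : ℕ) * derivPotential (2 * q) L a 0)) := by ring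
    _ ≤ 2 ^ n * (R + R / R ^ (2 * q) * R ^ (2 * q)) := by gcongr
    _ = 2 ^ n * (2 * R) := by rw [div_mul_cancel₀ _ (by positivity)]; ring

end ParityTree

theorem RandomizedPDT.levelL1_toFun_le {n d : ℕ} (R : RandomizedPDT n d) (hn : 2 ≤ n) {l : ℕ}
    (hl : 1 ≤ l) :
    levelL1 l R.toFun ≤ (d : ℝ) ^ ((l : ℝ) / 2) * (48 * (l * Real.logb 2 n)) ^ l := by
  have := R.isProbabilityMeasure
  have hint : ∀ x : Cube n,
      Integrable (fun T : PDT n => if T.1.eval x = true then (1 : ℝ) else 0) R.law := fun x =>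
    Integrable.of_mem_Icc 0 1 (measurable_from_top (f := fun T : PDT n =>
      if T.1.eval x = true then (1 : ℝ) else 0)).aemeasurable
      (Filter.Eventually.of_forall fun T => by cases T.1.eval x <;> simp)
  have hl1 : (1 : ℝ) ≤ l := by exact_mod_cast hl
  obtain ⟨hlog1, hlog2⟩ := natLog_le_logb hn
  have h : ∀ δ > (d : ℝ), levelL1 l R.toFun
      ≤ δ ^ ((l : ℝ) / 2) * (48 * (l * Real.logb 2 n)) ^ l := by
    intro δ hδ
    have hδ0 : 0 < δ := (Nat.cast_nonneg d).trans_lt hδ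
    have hB : levelL1 l R.toFun
        ≤ 2 * (6 * √(l * δ) * (2 * (Nat.log 2 n + 1) : ℕ)) ^ l := by
      refine levelL1_integral_le R.law _ hint l _ ?_
      filter_upwards [R.depth_le] with T hT a ha
      exact T.1.sum_eval_mul_le hl hδ0
        ((Nat.cast_le.2 hT).trans hδ.le) ha
    refine hB.trans ?_
    have e1 : δ ^ ((l : ℝ) / 2) = √δ ^ l := by
      rw [Real.sqrt_eq_rpow, ← Real.rpow_natCast, ← Real.rpow_mul hδ0.le]
      congr 1
      ring
    have hsq : √(l * δ) ≤ l * √δ := by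
      rw [Real.sqrt_mul (by positivity)]
      gcongr
      exact Real.sqrt_le_iff.2 ⟨by positivity, by nlinarith⟩
    -- The constant is 48 = 2 · 6 · 4, from 2 ≤ 2^l and p ≤ 4 log n.
    calc 2 * (6 * √(l * δ) * (2 * (Nat.log 2 n + 1) : ℕ)) ^ l
        ≤ 2 ^ l * (6 * (l * √δ) * (4 * Real.logb 2 n)) ^ l := by
          gcongr
          exact le_self_pow₀ (by norm_num) (by omega)
      _ = δ ^ ((l : ℝ) / 2) * (48 * (l * Real.logb 2 n)) ^ l := by
          rw [e1, ← mul_pow, ← mul_pow]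
          congr 1
          ring
  have hcont : Continuous fun δ : ℝ =>
      δ ^ ((l : ℝ) / 2) * (48 * (l * Real.logb 2 n)) ^ l :=
    (continuous_id.rpow_const fun _ => Or.inr (by positivity)).mul_const _
  exact ge_of_tendsto (hcont.continuousWithinAt (s := Set.Ioi (d : ℝ)) (x := (d : ℝ)))
    (Filter.eventually_of_mem self_mem_nhdsWithin h)

theorem corollary1p3 :
    (∃ C : ℝ, 0 < C ∧ ∀ (n d : ℕ) (R : RandomizedPDT n d), 2 ≤ n →
      ∀ l : ℕ, 1 ≤ l → l ≤ n →
        levelL1 l R.toFun ≤ (d : ℝ) ^ ((l : ℝ) / 2) * (C * (l * Real.logb 2 n)) ^ l) ∧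
    (∃ C : ℝ, 0 < C ∧ ∀ (n : ℕ) (d : ℝ) (R : RandomizedNoisyTree n d),
      ∀ l : ℕ, 1 ≤ l → l ≤ n →
        levelL1 l R.toFun ≤
          (C * d) ^ ((l : ℝ) / 2) * (l * Real.logb 2 n) ^ (((l : ℝ) - 1) / 2)) :=
  ⟨⟨48, by norm_num, fun _ _ R hn _ hl _ => R.levelL1_toFun_le hn hl⟩,
    ⟨20736, by norm_num, fun _ _ R _ hl hln => R.levelL1_toFun_le hl hln⟩⟩
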